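/- Consider the iterated function system $\mathcal S=\{S_i(x)=x/3+i\}_{i\in\mathcal A}$ on $\mathbb R$, where $\mathcal A=\{0,1,3\}$. For a finite word $\mathbf i=(i_1,\dots,i_n)\in\mathcal A^n$ write $S_{\mathbf i}=S_{i_1}\circ\cdots\circ S_{i_n}$. The system $\mathcal S$ satisfies the Weak Separation Property (the identity is not an accumulation point, for pointwise convergence, of $\{S_{\mathbf i}^{-1}\circ S_{\mathbf j}:\mathbf i,\mathbf j \text{ finite words}\}$), but it does not satisfy the Open Set Condition. Let $p=(p_0,p_1,p_3)$ with $p_i>0$ and $p_0+p_1+p_3=1$, write $p_{\mathbf i}=p_{i_1}\cdots p_{i_n}$, and let $\nu$ be the corresponding self-similar measure, that is, the image of the product measure $p^{\mathbb N}$ on $\mathcal A^{\mathbb N}$ under $\mathbf i\mapsto\sum_{k\ge1}i_k3^{-(k-1)}$. For $\mathbf i\in\mathcal A^n$ put $$\psi(\mathbf i)=\sum_{\eta\in\mathcal A^n,\ S_\eta=S_{\mathbf i}}p_\eta .$$ If $p_3\le p_1$, let $\mathcal T_n$ be the set of words of length $n$ over $\mathcal A$ in which the pair $(0,3)$ does not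 occur at consecutive positions; in the symmetric case $p_1\le p_3$ use the pair $(1,0)$ in place of $(0,3)$ (if $p_1=p_3$, either choice is allowed). Then for every $t\ge0$ the limit $$p(t)=\lim_{n\to\infty}\frac1n\log\sum_{\mathbf i\in\mathcal T_n}\psi(\mathbf i)^t$$ exists in $\mathbb R$, and for every $r>0$ there is a unique $t_0\in(0,1)$ with $p(t_0)=rt_0\log3$. The quantization dimension of $\nu$ of order $r$ exists and $$D_r(\nu)=\chi_r=\frac{t_0r}{1-t_0}.$$ Here $V_{n,r}(\nu)=\inf\{\int d(x,\alpha)^r\,d\nu(x):\alpha\subset\mathbb R,\ 1\le\operatorname{card}\alpha\le n\}$ and $e_{n,r}(\nu)=V_{n,r}(\nu)^{1/r}$; that $D_r(\nu)$ exists means that the lower limit and the upper limit of $\frac{\log n}{-\log e_{n,r}(\nu)}$ as $n\to\infty$ coincide, and $D_r(\nu)$ is their common value. -/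

import Mathlib

open MeasureTheory Filter Topology
open scoped ENNReal

noncomputable section

namespace Overlap

/-! ### Iterated function systems, the weak separation property, the open set condition -/

/-- The composition `S_{i₁} ∘ ⋯ ∘ S_{iₙ}` along a finite word; the identity for the empty word. -/
def comp {ι X : Type*} (S : ι → X → X) (w : List ι) : X → X :=
  w.foldr (fun i f => S i ∘ f) id

/-- The weak separation property of an iterated function system of bijections (such as
similarities): the identity is not an accumulation point, for pointwise convergence, of the set
`{S_v⁻¹ ∘ S_w : v, w finite words}`.  The map `g = S_v⁻¹ ∘ S_w` is written as the solution of
`S_v ∘ g = S_w`. -/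
def WeakSeparation {ι X : Type*} [TopologicalSpace X] (S : ι → X → X) : Prop :=
  (id : X → X) ∉ closure ({g : X → X | ∃ v w : List ι, comp S v ∘ g = comp S w} \ {id})

/-- The open set condition. -/
def OpenSetCondition {ι X : Type*} [TopologicalSpace X] (S : ι → X → X) : Prop :=
  ∃ U : Set X, IsOpen U ∧ U.Nonempty ∧ (∀ i, S i '' U ⊆ U) ∧
    ∀ i j, i ≠ j → Disjoint (S i '' U) (S j '' U)

/-! ### Quantization dimension -/

section Quantization

variable {X : Type*} [PseudoMetricSpace X] [MeasurableSpace X]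

/-- The `n`-th quantization error `V_{n,r}(μ)` of order `r`, as an extended nonnegative real: the
infimum of `∫ d(x, α)^r dμ(x)` over the sets `α` with `1 ≤ card α ≤ n`. -/
def quantizationError (μ : Measure X) (r : ℝ) (n : ℕ) : ℝ≥0∞ :=
  ⨅ (α : Finset X) (_ : 1 ≤ α.card ∧ α.card ≤ n),
    ∫⁻ x, ENNReal.ofReal (Metric.infDist x (α : Set X) ^ r) ∂μ

/-- `e_{n,r}(μ) = V_{n,r}(μ)^{1/r}`. -/
def normalizedError (μ : Measure X) (r : ℝ) (n : ℕ) : ℝ :=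
  (quantizationError μ r n).toReal ^ (1 / r)

/-- The lower quantization dimension of order `r`. -/
def lowerQuantizationDim (μ : Measure X) (r : ℝ) : EReal :=
  liminf (fun n : ℕ => ((Real.log n / -Real.log (normalizedError μ r n) : ℝ) : EReal)) atTop

/-- The upper quantization dimension of order `r`. -/
def upperQuantizationDim (μ : Measure X) (r : ℝ) : EReal :=
  limsup (fun n : ℕ => ((Real.log n / -Real.log (normalizedError μ r n) : ℝ) : EReal)) atTop

/-- The quantization dimension of order `r` exists and equals `D`. -/
def HasQuantizationDim (μ : Measure X) (r : ℝ) (D : ℝ) : Prop :=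
  lowerQuantizationDim μ r = (D : EReal) ∧ upperQuantizationDim μ r = (D : EReal)

end Quantization

/-! ### The system `{x/3, x/3 + 1, x/3 + 3}`

The three letters are indexed by `Fin 3`: the indices `0`, `1`, `2` stand for the digits
`0`, `1`, `3`.  So `p 0`, `p 1`, `p 2` are the probabilities `p₀`, `p₁`, `p₃`. -/

/-- The digit that an index stands for. -/
def digit : Fin 3 → ℝ := ![0, 1, 3]

/-- The maps `x ↦ x/3 + i` for `i` in `{0, 1, 3}`. -/
def S (i : Fin 3) (x : ℝ) : ℝ := x / 3 + digit i

/-- The map `S_w` of a word `w` of length `n`. -/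
def wordMap {n : ℕ} (w : Fin n → Fin 3) : ℝ → ℝ := comp S (List.ofFn w)

/-- The natural projection of an infinite word (with positions counted from `0`). -/
def proj (ω : ℕ → Fin 3) : ℝ := ∑' k : ℕ, digit (ω k) * (3 ^ k)⁻¹

/-- The measure on the letters with weights `p`. -/
def letterMeasure (p : Fin 3 → ℝ) : Measure (Fin 3) :=
  ∑ i, ENNReal.ofReal (p i) • Measure.dirac i

/-- The self-similar measure: the image under the natural projection of the product measure
`p^ℕ` on infinite words. -/
def selfSimilarMeasure (p : Fin 3 → ℝ) : Measure ℝ :=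
  (Measure.infinitePi fun _ : ℕ => letterMeasure p).map proj

/-- `p_w`, the product of the probabilities of the letters of `w`. -/
def wordProb (p : Fin 3 → ℝ) {n : ℕ} (w : Fin n → Fin 3) : ℝ := ∏ k, p (w k)

open Classical in
/-- `ψ(w)`, the sum of `p_η` over all words `η` of the length of `w` with `S_η = S_w`. -/
def psi (p : Fin 3 → ℝ) {n : ℕ} (w : Fin n → Fin 3) : ℝ :=
  ∑ η : Fin n → Fin 3 with wordMap η = wordMap w, wordProb p η

/-- The pair `ab` does not occur at consecutive positions of `w`. -/
def Avoids (a b : Fin 3) {n : ℕ} (w : Fin n → Fin 3) : Prop :=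
  ∀ k l : Fin n, (l : ℕ) = k + 1 → ¬(w k = a ∧ w l = b)

open Classical in
/-- `1/n` times the logarithm of the sum of `ψ^t` over the words of length `n` that avoid `ab`. -/
def pressureSeq (p : Fin 3 → ℝ) (a b : Fin 3) (t : ℝ) (n : ℕ) : ℝ :=
  1 / (n : ℝ) * Real.log (∑ w : Fin n → Fin 3 with Avoids a b w, psi p w ^ t)

/-- The pressure of `ψ^t` over the subshift of finite type that forbids `ab`. -/
def pressure (p : Fin 3 → ℝ) (a b : Fin 3) (t : ℝ) : ℝ :=
  limsup (pressureSeq p a b t) atTop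

end Overlap

end

/-! Everything reduces to integers: `S_w` is determined by the length of `w` and by `val w`, its
value in base 3 with digits 0, 1, 3. The only source of coincidences is 03 = 10, so each class of
words with equal maps has exactly one member avoiding the forbidden pair (`avoids_bijective`). Hence
the sum over `T_n` is the partition function `Z_n(t)`, the sum over the values `a` of `mass p n a ^
t` (`pressureSeq_eq`).

Concatenation of classes is at most two-to-one and masses are supermultiplicative, so `Z_n Z_m ≤ 2
Z_{n+m}` (`partition_mul_le`) and Fekete's lemma gives the pressure. It is nonincreasing and
Lipschitz on `t ≥ 0`, at least `log 2` at 0, and 0 at 1; it therefore meets the strictly increasing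
line `r t log 3` exactly once, at a point of (0,1).

For the dimension, give the cell `(n, a)`, of diameter comparable to `3^{-n}`, the weight `mass ·
3^{-nr}`. The `t`-th powers of the weights of level `n` have sum `Z_n(t) 3^{-nrt}`. For `t > t₀`
these sums are summable over `n`; stopping each infinite word when the weight first drops below `ε`
gives `O(ε^{-t})` cells of error at most a constant times `ε` (`exists_quantizationError_le`). For
`t < t' < t₀` the sums at `t'` are unbounded, so some level carries at least `s^{-t}` well separated
cells of weight at least `s`. Concatenating them gives such families at arbitrarily deep levels, and
`N` points miss half of `2N` separated cells (`exists_le_quantizationError_of_separated`). Thus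
`V_{N,r}` is squeezed between powers of `N` with exponents tending to `1 - 1/t₀`. -/

noncomputable section

namespace Overlap

/-! ### Words and their values -/

/-- The digits as natural numbers. -/
def natDigit : Fin 3 → ℕ := ![0, 1, 3]

lemma digit_eq (i : Fin 3) : digit i = natDigit i := by
  fin_cases i <;> simp [digit, natDigit]

lemma natDigit_le (i : Fin 3) : natDigit i ≤ 3 := by
  fin_cases i <;> simp [natDigit]

/-- The integer with the digits `w` in base `3`. -/
def val {n : ℕ} (w : Fin n → Fin 3) : ℕ := ∑ k : Fin n, natDigit (w k) * 3 ^ (n - 1 - (k : ℕ))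

lemma val_zero (w : Fin 0 → Fin 3) : val w = 0 := by simp [val]

lemma val_cons {n : ℕ} (i : Fin 3) (w : Fin n → Fin 3) :
    val (Fin.cons i w : Fin (n + 1) → Fin 3) = natDigit i * 3 ^ n + val w := by
  simp only [val, Fin.sum_univ_succ, Fin.cons_zero, Fin.cons_succ, Fin.val_zero, Fin.val_succ]
  congr 1
  refine Finset.sum_congr rfl fun k _ => ?_
  congr 2
  omega

lemma val_snoc {n : ℕ} (w : Fin n → Fin 3) (i : Fin 3) :
    val (Fin.snoc w i : Fin (n + 1) → Fin 3) = 3 * val w + natDigit i := by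
  simp only [val, Fin.sum_univ_castSucc, Fin.snoc_castSucc, Fin.snoc_last, Fin.val_last,
    Fin.val_castSucc, Finset.mul_sum]
  congr 1
  · refine Finset.sum_congr rfl fun k _ => ?_
    rw [show n + 1 - 1 - (k : ℕ) = (n - 1 - (k : ℕ)) + 1 by omega, pow_succ]
    ring
  · simp

lemma val_append {n m : ℕ} (u : Fin n → Fin 3) (v : Fin m → Fin 3) :
    val (Fin.append u v) = val u * 3 ^ m + val v := by
  simp only [val, Fin.sum_univ_add, Fin.append_left, Fin.append_right, Fin.val_castAdd,
    Fin.val_natAdd, Finset.sum_mul]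
  congr 1
  · refine Finset.sum_congr rfl fun k _ => ?_
    rw [mul_assoc, ← pow_add]
    congr 2
    omega
  · refine Finset.sum_congr rfl fun k _ => ?_
    congr 2
    omega

/-- Equality holds for the word with all digits 3. The bound `val w < 2 · 3 ^ n` is what limits the
overlap of cells. -/
lemma two_mul_val_add_le {n : ℕ} (w : Fin n → Fin 3) : 2 * val w + 3 ≤ 3 * 3 ^ n := by
  induction n with
  | zero => simp [val_zero]
  | succ n ih =>
    obtain ⟨i, u, rfl⟩ : ∃ i u, w = Fin.cons i u := ⟨w 0, Fin.tail w, (Fin.cons_self_tail w).symm⟩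
    rw [val_cons, pow_succ]
    have h1 := ih u
    have h2 := Nat.mul_le_mul_right (3 ^ n) (natDigit_le i)
    linarith

lemma wordMap_apply {n : ℕ} (w : Fin n → Fin 3) (x : ℝ) :
    wordMap w x = x / 3 ^ n + 3 * val w / 3 ^ n := by
  induction n with
  | zero => simp [wordMap, comp, val_zero]
  | succ n ih =>
    obtain ⟨i, u, rfl⟩ : ∃ i u, w = Fin.cons i u := ⟨w 0, Fin.tail w, (Fin.cons_self_tail w).symm⟩
    have h : wordMap (Fin.cons i u : Fin (n + 1) → Fin 3) x = S i (wordMap u x) := by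
      simp [wordMap, comp, List.ofFn_succ]
    rw [h, ih, S, val_cons, digit_eq]
    push_cast
    field_simp
    ring

lemma wordMap_eq_iff {n : ℕ} (u v : Fin n → Fin 3) : wordMap u = wordMap v ↔ val u = val v := by
  constructor
  · intro h
    have h0 := congrFun h 0
    rw [wordMap_apply, wordMap_apply] at h0
    have h3 : (3 : ℝ) ^ n ≠ 0 := by positivity
    field_simp at h0
    have : (val u : ℝ) = val v := by linarith
    exact_mod_cast this
  · intro h
    funext x
    rw [wordMap_apply, wordMap_apply, h]

lemma comp_eq_wordMap (l : List (Fin 3)) : comp S l = wordMap l.get := by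
  rw [wordMap, List.ofFn_get]

/-! ### The weak separation property and the open set condition -/

/-- A map `S_v⁻¹ ∘ S_w` has slope a power of 3. Closeness to the identity at 0 and 1 forces slope 1;
it is then a translation by a multiple of 3 smaller than 1/4 in modulus, hence the identity. -/
lemma weakSeparation_S : WeakSeparation S := by
  intro hcl
  have hopen : IsOpen {g : ℝ → ℝ | |g 0| < 1 / 4 ∧ |g 1 - 1| < 1 / 4} := by
    refine IsOpen.inter ?_ ?_
    · exact isOpen_lt (f := fun g : ℝ → ℝ => |g 0|) (by fun_prop) continuous_const
    · exact isOpen_lt (f := fun g : ℝ → ℝ => |g 1 - 1|) (by fun_prop) continuous_const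
  obtain ⟨g, ⟨hg0, hg1⟩, ⟨v, w, hvw⟩, hne⟩ := mem_closure_iff.1 hcl _ hopen (by norm_num)
  apply hne
  rw [comp_eq_wordMap, comp_eq_wordMap] at hvw
  have key : ∀ x, g x / 3 ^ v.length + 3 * val v.get / 3 ^ v.length =
      x / 3 ^ w.length + 3 * val w.get / 3 ^ w.length := fun x => by
    rw [← wordMap_apply, ← wordMap_apply, ← hvw, Function.comp_apply]
  generalize val v.get = a at key
  generalize val w.get = b at key
  generalize v.length = m at key
  generalize w.length = n at key
  rw [abs_lt] at hg0 hg1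
  have hm : (0 : ℝ) < 3 ^ m := by positivity
  have hn : (0 : ℝ) < 3 ^ n := by positivity
  have hslope : (g 1 - g 0) * 3 ^ n = 3 ^ m := by
    have h1 := key 1
    have h0 := key 0
    field_simp at h0 h1
    linear_combination h1 - h0
  rcases lt_trichotomy m n with h | rfl | h
  · obtain ⟨k, rfl⟩ := Nat.exists_eq_add_of_lt h
    have hk : (1 : ℝ) ≤ 3 ^ k := one_le_pow₀ (by norm_num)
    rw [pow_succ, pow_add] at hslope
    have : (g 1 - g 0) * 3 ^ k * 3 = 1 := by
      apply mul_right_cancel₀ hm.ne'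
      linear_combination hslope
    nlinarith
  · have hx : ∀ x, g x = x + 3 * ((b : ℝ) - a) := fun x => by
      have := key x
      field_simp at this
      linear_combination this
    have hab : (b : ℤ) - a = 0 := by
      rw [hx] at hg0
      have h1 : (-1 : ℝ) < ((b : ℤ) - a : ℤ) := by push_cast; linarith
      have h2 : (((b : ℤ) - a : ℤ) : ℝ) < 1 := by push_cast; linarith
      have h1' : -1 < (b : ℤ) - a := by exact_mod_cast h1
      have h2' : (b : ℤ) - a < 1 := by exact_mod_cast h2
      omega
    have hab' : (b : ℝ) - a = 0 := by exact_mod_cast hab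
    rw [Set.mem_singleton_iff]
    funext x
    rw [hx, hab']
    simp
  · obtain ⟨k, rfl⟩ := Nat.exists_eq_add_of_lt h
    have hk : (1 : ℝ) ≤ 3 ^ k := one_le_pow₀ (by norm_num)
    rw [pow_succ, pow_add] at hslope
    have : g 1 - g 0 = 3 ^ k * 3 := by
      apply mul_right_cancel₀ hn.ne'
      linear_combination hslope
    nlinarith

/-- The exact overlap `S_0 ∘ S_3 = S_1 ∘ S_0` puts a common point into the images of `U` under `S_0`
and `S_1`. -/
lemma not_openSetCondition_S : ¬ OpenSetCondition S := by
  rintro ⟨U, -, ⟨x, hx⟩, hU, hd⟩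
  have h2 : S 2 x ∈ U := hU 2 ⟨x, hx, rfl⟩
  have h0 : S 0 x ∈ U := hU 0 ⟨x, hx, rfl⟩
  refine Set.disjoint_left.1 (hd 0 1 (by decide)) ⟨_, h2, rfl⟩ ⟨_, h0, ?_⟩
  simp [S, digit]
  ring

/-! ### Normal forms -/

lemma avoids_cons_cons {a b i j : Fin 3} {n : ℕ} (w : Fin n → Fin 3) :
    Avoids a b (Fin.cons i (Fin.cons j w : Fin (n + 1) → Fin 3) : Fin (n + 2) → Fin 3) ↔
      ¬(i = a ∧ j = b) ∧ Avoids a b (Fin.cons j w : Fin (n + 1) → Fin 3) := by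
  constructor
  · intro h
    refine ⟨fun hij => h 0 1 (by simp) ⟨by simpa using hij.1, ?_⟩, fun k l hkl => ?_⟩
    · exact hij.2
    · have := h k.succ l.succ (by simp [hkl])
      simpa using this
  · rintro ⟨h1, h2⟩ k l hkl
    induction k using Fin.cases with
    | zero =>
      obtain rfl : l = 1 := by ext; simpa using hkl
      exact h1
    | succ k =>
      induction l using Fin.cases with
      | zero => simp at hkl
      | succ l =>
        have := h2 k l (by simpa using hkl)
        simpa using this

lemma avoids_snoc_snoc {a b i j : Fin 3} {n : ℕ} (w : Fin n → Fin 3) :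
    Avoids a b (Fin.snoc (Fin.snoc w i : Fin (n + 1) → Fin 3) j : Fin (n + 2) → Fin 3) ↔
      Avoids a b (Fin.snoc w i : Fin (n + 1) → Fin 3) ∧ ¬(i = a ∧ j = b) := by
  constructor
  · intro h
    refine ⟨fun k l hkl => ?_, fun hij => ?_⟩
    · have := h k.castSucc l.castSucc (by simpa using hkl)
      simpa only [Fin.snoc_castSucc] using this
    · refine h (Fin.last n).castSucc (Fin.last _) (by simp) ?_
      simpa only [Fin.snoc_castSucc, Fin.snoc_last] using hij
  · rintro ⟨h1, h2⟩ k l hkl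
    induction k using Fin.lastCases with
    | last => have := l.2; simp at hkl; omega
    | cast k =>
      induction l using Fin.lastCases with
      | last =>
        obtain rfl : k = Fin.last n := by ext; simp at hkl; simp; omega
        simpa only [Fin.snoc_castSucc, Fin.snoc_last] using h2
      | cast l =>
        have := h1 k l (by simpa using hkl)
        simpa only [Fin.snoc_castSucc] using this

lemma Avoids.of_snoc {a b j : Fin 3} {n : ℕ} {w : Fin n → Fin 3}
    (h : Avoids a b (Fin.snoc w j : Fin (n + 1) → Fin 3)) : Avoids a b w := by
  intro k l hkl
  have := h k.castSucc l.castSucc (by simpa using hkl)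
  simpa only [Fin.snoc_castSucc] using this

lemma avoids_of_le_one {a b : Fin 3} (w : Fin 1 → Fin 3) : Avoids a b w := by
  intro k l hkl
  omega

lemma exists_snoc {n : ℕ} (w : Fin (n + 1) → Fin 3) : ∃ u i, w = Fin.snoc u i :=
  ⟨Fin.init w, w (Fin.last n), (Fin.snoc_init_self w).symm⟩

lemma exists_cons {n : ℕ} (w : Fin (n + 1) → Fin 3) : ∃ i u, w = Fin.cons i u :=
  ⟨w 0, Fin.tail w, (Fin.cons_self_tail w).symm⟩

/-- A final 03 is rewritten as 10. Working from the last letter, no cascade occurs: the new 1 cannot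
end a pair 03. -/
lemma exists_avoids_zero_two {n : ℕ} (w : Fin n → Fin 3) :
    ∃ u : Fin n → Fin 3, Avoids 0 2 u ∧ val u = val w := by
  induction n with
  | zero => exact ⟨w, fun k => k.elim0, rfl⟩
  | succ n ih =>
    obtain ⟨w, i, rfl⟩ := exists_snoc w
    obtain ⟨u, hu, huw⟩ := ih w
    rcases n with _ | n
    · exact ⟨_, avoids_of_le_one _, rfl⟩
    obtain ⟨u, j, rfl⟩ := exists_snoc u
    by_cases hji : j = 0 ∧ i = 2
    · obtain ⟨rfl, rfl⟩ := hji
      refine ⟨Fin.snoc (Fin.snoc u 1 : Fin (n + 1) → Fin 3) 0, ?_, ?_⟩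
      · rw [avoids_snoc_snoc]
        refine ⟨?_, by decide⟩
        rcases n with _ | n
        · exact avoids_of_le_one _
        · obtain ⟨u, k, rfl⟩ := exists_snoc u
          rw [avoids_snoc_snoc]
          exact ⟨hu.of_snoc, by simp⟩
      · rw [val_snoc, val_snoc, val_snoc, ← huw, val_snoc]
        simp [natDigit]; ring
    · refine ⟨Fin.snoc (Fin.snoc u j : Fin (n + 1) → Fin 3) i, ?_, ?_⟩
      · rw [avoids_snoc_snoc]; exact ⟨hu, hji⟩
      · rw [val_snoc, huw, val_snoc]

/-- The mirror image: an initial 10 becomes 03, and the new 3 cannot begin a pair 10, so the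
recursion runs from the first letter. -/
lemma exists_avoids_one_zero {n : ℕ} (w : Fin n → Fin 3) :
    ∃ u : Fin n → Fin 3, Avoids 1 0 u ∧ val u = val w := by
  induction n with
  | zero => exact ⟨w, fun k => k.elim0, rfl⟩
  | succ n ih =>
    obtain ⟨i, w, rfl⟩ := exists_cons w
    obtain ⟨u, hu, huw⟩ := ih w
    rcases n with _ | n
    · exact ⟨_, avoids_of_le_one _, rfl⟩
    obtain ⟨j, u, rfl⟩ := exists_cons u
    by_cases hji : i = 1 ∧ j = 0
    · obtain ⟨rfl, rfl⟩ := hji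
      refine ⟨Fin.cons 0 (Fin.cons 2 u : Fin (n + 1) → Fin 3), ?_, ?_⟩
      · rw [avoids_cons_cons]
        refine ⟨by decide, ?_⟩
        rcases n with _ | n
        · exact avoids_of_le_one _
        · obtain ⟨k, u, rfl⟩ := exists_cons u
          rw [avoids_cons_cons] at hu ⊢
          exact ⟨by simp, hu.2⟩
      · rw [val_cons, val_cons, val_cons, ← huw, val_cons]
        simp [natDigit]; ring
    · refine ⟨Fin.cons i (Fin.cons j u : Fin (n + 1) → Fin 3), ?_, ?_⟩
      · rw [avoids_cons_cons]; exact ⟨hji, hu⟩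
      · rw [val_cons, huw, val_cons]

/-- Descent modulo 3, where values are only 0 or 1. The word `u` cannot end in 0; if it ends in 1,
then `val u + 1` has residue 2; if it ends in 3, then `w` ends in 1 and the same equation holds for
the shorter prefixes. -/
lemma val_ne_val_add_one_of_avoids_zero_two {n : ℕ} (w u : Fin n → Fin 3)
    (hu : Avoids 0 2 (Fin.snoc u 2 : Fin (n + 1) → Fin 3)) : val w ≠ val u + 1 := by
  induction n with
  | zero => simp [val_zero]
  | succ n ih =>
    obtain ⟨w, i, rfl⟩ := exists_snoc w
    obtain ⟨u, j, rfl⟩ := exists_snoc u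
    rw [val_snoc, val_snoc]
    rw [avoids_snoc_snoc] at hu
    fin_cases j
    · simp at hu
    · fin_cases i <;> simp [natDigit] <;> omega
    · have := ih w u hu.1
      fin_cases i <;> simp [natDigit] <;> omega

/-- Since `w` cannot end in 1, a nonempty `w` has value 0 modulo 3, whereas `val u + 1` has residue
1 or 2. -/
lemma val_add_one_ne_val_of_avoids_one_zero {n : ℕ} (w u : Fin n → Fin 3)
    (hw : Avoids 1 0 (Fin.snoc w 0 : Fin (n + 1) → Fin 3)) : val w ≠ val u + 1 := by
  rcases n with _ | n
  · simp [val_zero]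
  · obtain ⟨w, i, rfl⟩ := exists_snoc w
    obtain ⟨u, j, rfl⟩ := exists_snoc u
    rw [val_snoc, val_snoc]
    rw [avoids_snoc_snoc] at hw
    fin_cases i
    · fin_cases j <;> simp [natDigit] <;> omega
    · simp at hw
    · fin_cases j <;> simp [natDigit] <;> omega

/-- Different last letters are compatible modulo 3 only if they are the digits 0 and 3; the prefixes
then have values differing by one, which is what `H` excludes. -/
lemma val_injOn_of_snoc {a b : Fin 3}
    (H : ∀ {n : ℕ} (w u : Fin n → Fin 3), Avoids a b (Fin.snoc w 0 : Fin (n + 1) → Fin 3) →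
      Avoids a b (Fin.snoc u 2 : Fin (n + 1) → Fin 3) → val w ≠ val u + 1)
    {n : ℕ} (w u : Fin n → Fin 3) (hw : Avoids a b w) (hu : Avoids a b u)
    (h : val w = val u) : w = u := by
  induction n with
  | zero => exact Subsingleton.elim _ _
  | succ n ih =>
    obtain ⟨w, i, rfl⟩ := exists_snoc w
    obtain ⟨u, j, rfl⟩ := exists_snoc u
    rw [val_snoc, val_snoc] at h
    by_cases hij : i = j
    · subst hij
      rw [ih w u hw.of_snoc hu.of_snoc (by omega)]
    · exfalso
      fin_cases i <;> fin_cases j <;> simp [natDigit] at h hij <;> try omega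
      · exact H w u hw hu (by omega)
      · exact H u w hu hw (by omega)

lemma avoids_bijective {a b : Fin 3} (hab : (a = 0 ∧ b = 2) ∨ (a = 1 ∧ b = 0)) (n : ℕ) :
    (∀ w : Fin n → Fin 3, ∃ u : Fin n → Fin 3, Avoids a b u ∧ val u = val w) ∧
      ∀ w u : Fin n → Fin 3, Avoids a b w → Avoids a b u → val w = val u → w = u := by
  rcases hab with ⟨rfl, rfl⟩ | ⟨rfl, rfl⟩
  · exact ⟨exists_avoids_zero_two, val_injOn_of_snoc
      fun w u _ hu => val_ne_val_add_one_of_avoids_zero_two w u hu⟩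
  · exact ⟨exists_avoids_one_zero, val_injOn_of_snoc
      fun w u hw _ => val_add_one_ne_val_of_avoids_one_zero w u hw⟩

/-! ### Masses of the classes of words and their partition function -/

/-- The values of the words of length `n`. -/
def values (n : ℕ) : Finset ℕ := Finset.univ.image (val (n := n))

lemma val_mem_values {n : ℕ} (w : Fin n → Fin 3) : val w ∈ values n :=
  Finset.mem_image_of_mem _ (Finset.mem_univ w)

lemma mem_values {n a : ℕ} : a ∈ values n ↔ ∃ w : Fin n → Fin 3, val w = a := by
  simp [values]

lemma values_zero : values 0 = {0} := by
  ext a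
  simp [mem_values, val_zero, eq_comm]

lemma two_mul_add_three_le {n a : ℕ} (ha : a ∈ values n) : 2 * a + 3 ≤ 3 * 3 ^ n := by
  obtain ⟨w, rfl⟩ := mem_values.1 ha
  exact two_mul_val_add_le w

lemma mul_add_mem_values {n m a b : ℕ} (ha : a ∈ values n) (hb : b ∈ values m) :
    a * 3 ^ m + b ∈ values (n + m) := by
  obtain ⟨u, rfl⟩ := mem_values.1 ha
  obtain ⟨v, rfl⟩ := mem_values.1 hb
  exact mem_values.2 ⟨Fin.append u v, val_append u v⟩

lemma card_values_le (n : ℕ) : (values n).card ≤ 3 ^ n := by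
  refine Finset.card_image_le.trans ?_
  simp

lemma two_pow_le_card_values (n : ℕ) : 2 ^ n ≤ (values n).card := by
  induction n with
  | zero => simp [values_zero]
  | succ n ih =>
    have hinj0 : Set.InjOn (fun a : ℕ => 3 * a) (values n) := fun a _ b _ h => by simpa using h
    have hinj1 : Set.InjOn (fun a : ℕ => 3 * a + 1) (values n) := fun a _ b _ h => by simpa using h
    have hd : Disjoint ((values n).image fun a : ℕ => 3 * a)
        ((values n).image fun a : ℕ => 3 * a + 1) := by
      rw [Finset.disjoint_left]
      rintro c hc hc'
      simp only [Finset.mem_image] at hc hc'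
      omega
    calc 2 ^ (n + 1) ≤ (values n).card + (values n).card := by rw [pow_succ]; omega
      _ = (((values n).image fun a : ℕ => 3 * a) ∪
            ((values n).image fun a : ℕ => 3 * a + 1)).card := by
          rw [Finset.card_union_of_disjoint hd, Finset.card_image_of_injOn hinj0,
            Finset.card_image_of_injOn hinj1]
      _ ≤ (values (n + 1)).card := by
          refine Finset.card_le_card fun c hc => ?_
          simp only [Finset.mem_union, Finset.mem_image] at hc
          rcases hc with ⟨a, ha, rfl⟩ | ⟨a, ha, rfl⟩ <;> obtain ⟨w, rfl⟩ := mem_values.1 ha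
          · exact mem_values.2 ⟨Fin.snoc w 0, by simp [val_snoc, natDigit]⟩
          · exact mem_values.2 ⟨Fin.snoc w 1, by simp [val_snoc, natDigit]⟩

/-- The total probability of the words of length `n` with value `a`. -/
def mass (p : Fin 3 → ℝ) (n a : ℕ) : ℝ := ∑ η : Fin n → Fin 3 with val η = a, wordProb p η

/-- The partition function `∑ ψ^t` over the classes of words of length `n`. -/
def partition (p : Fin 3 → ℝ) (n : ℕ) (t : ℝ) : ℝ := ∑ a ∈ values n, mass p n a ^ t

lemma psi_eq_mass (p : Fin 3 → ℝ) {n : ℕ} (w : Fin n → Fin 3) : psi p w = mass p n (val w) := by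
  classical
  rw [psi, mass]
  refine Finset.sum_congr ?_ fun _ _ => rfl
  ext η
  simp [wordMap_eq_iff]

lemma pressureSeq_eq (p : Fin 3 → ℝ) {a b : Fin 3}
    (hab : (a = 0 ∧ b = 2) ∨ (a = 1 ∧ b = 0)) (t : ℝ) (n : ℕ) :
    pressureSeq p a b t n = 1 / (n : ℝ) * Real.log (partition p n t) := by
  classical
  obtain ⟨hsurj, hinj⟩ := avoids_bijective hab n
  rw [pressureSeq, partition]
  congr 2
  refine Finset.sum_bij (fun w _ => val w) (fun w _ => val_mem_values w) ?_ ?_ ?_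
  · intro w hw u hu h
    simp only [Finset.mem_filter] at hw hu
    exact hinj w u hw.2 hu.2 h
  · intro c hc
    obtain ⟨w, rfl⟩ := mem_values.1 hc
    obtain ⟨u, hu, huw⟩ := hsurj w
    exact ⟨u, by simpa using hu, huw⟩
  · intro w _
    rw [psi_eq_mass]

section

variable {p : Fin 3 → ℝ} (hp : ∀ i, 0 < p i)

include hp

lemma wordProb_pos {n : ℕ} (w : Fin n → Fin 3) : 0 < wordProb p w :=
  Finset.prod_pos fun _ _ => hp _

lemma mass_nonneg (n a : ℕ) : 0 ≤ mass p n a :=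
  Finset.sum_nonneg fun w _ => (wordProb_pos hp w).le

lemma wordProb_le_mass {n : ℕ} (w : Fin n → Fin 3) : wordProb p w ≤ mass p n (val w) :=
  Finset.single_le_sum (f := fun w => wordProb p w) (fun u _ => (wordProb_pos hp u).le)
    (by simp)

lemma mass_pos {n a : ℕ} (ha : a ∈ values n) : 0 < mass p n a := by
  obtain ⟨w, rfl⟩ := mem_values.1 ha
  exact (wordProb_pos hp w).trans_le (wordProb_le_mass hp w)

lemma pow_le_mass {c : ℝ} (hc : 0 ≤ c) (hcp : ∀ i, c ≤ p i) {n a : ℕ} (ha : a ∈ values n) :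
    c ^ n ≤ mass p n a := by
  obtain ⟨w, rfl⟩ := mem_values.1 ha
  refine le_trans ?_ (wordProb_le_mass hp w)
  calc c ^ n = ∏ _k : Fin n, c := by simp
    _ ≤ wordProb p w := Finset.prod_le_prod (fun _ _ => hc) fun _ _ => hcp _

/-- Concatenation injects pairs of words into the class of `a * 3 ^ m + b`, which may contain
further words. -/
lemma mass_mul_mass_le (n m a b : ℕ) :
    mass p n a * mass p m b ≤ mass p (n + m) (a * 3 ^ m + b) := by
  rw [mass, mass, Finset.sum_mul_sum, ← Finset.sum_product', mass]
  have : ∀ x : (Fin n → Fin 3) × (Fin m → Fin 3),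
      wordProb p x.1 * wordProb p x.2 = wordProb p (Fin.append x.1 x.2) := fun x => by
    simp [wordProb, Fin.prod_univ_add]
  simp_rw [this]
  rw [← Finset.sum_image (f := fun w : Fin (n + m) → Fin 3 => wordProb p w)
    (g := fun x : (Fin n → Fin 3) × (Fin m → Fin 3) => Fin.append x.1 x.2)
    ((Fin.appendEquiv n m).injective.injOn)]
  refine Finset.sum_le_sum_of_subset_of_nonneg ?_ fun w _ _ => (wordProb_pos hp w).le
  intro w hw
  simp only [Finset.mem_image, Finset.mem_product, Finset.mem_filter, Finset.mem_univ,
    true_and, Prod.exists] at hw ⊢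
  obtain ⟨u, v, ⟨rfl, rfl⟩, rfl⟩ := hw
  exact val_append u v

lemma partition_pos (n : ℕ) (t : ℝ) : 0 < partition p n t :=
  Finset.sum_pos (fun _ ha => Real.rpow_pos_of_pos (mass_pos hp ha) t)
    ⟨_, val_mem_values (fun _ => 0)⟩

/-- Since `b < 2 · 3 ^ m`, the equation `a * 3 ^ m + b = c` leaves two candidates for `a`, the
quotient `c / 3 ^ m` and its predecessor, and `a` determines `b`. This is the source of the factor
2. -/
lemma partition_mul_le (n m : ℕ) {t : ℝ} (ht : 0 ≤ t) :
    partition p n t * partition p m t ≤ 2 * partition p (n + m) t := by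
  rw [partition, partition, Finset.sum_mul_sum, ← Finset.sum_product']
  have hmaps : ∀ x ∈ values n ×ˢ values m, x.1 * 3 ^ m + x.2 ∈ values (n + m) := fun x hx => by
    rw [Finset.mem_product] at hx
    exact mul_add_mem_values hx.1 hx.2
  rw [← Finset.sum_fiberwise_of_maps_to hmaps, partition, Finset.mul_sum]
  refine Finset.sum_le_sum fun c hc => ?_
  have hcard : ((values n ×ˢ values m).filter fun x => x.1 * 3 ^ m + x.2 = c).card ≤ 2 := by
    have hinj : Set.InjOn Prod.fst
        (((values n ×ˢ values m).filter fun x => x.1 * 3 ^ m + x.2 = c : Finset (ℕ × ℕ)) :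
          Set (ℕ × ℕ)) := by
      rintro ⟨a, b⟩ hab ⟨a', b'⟩ hab' h
      rw [Finset.mem_coe, Finset.mem_filter] at hab hab'
      obtain rfl : a = a' := h
      have := hab.2.trans hab'.2.symm
      rw [Prod.mk.injEq]
      exact ⟨rfl, Nat.add_left_cancel this⟩
    rw [← Finset.card_image_of_injOn hinj]
    refine (Finset.card_le_card (t := {c / 3 ^ m, c / 3 ^ m - 1}) ?_).trans Finset.card_le_two
    intro a ha
    simp only [Finset.mem_image, Finset.mem_filter, Finset.mem_product, Prod.exists,
      exists_and_right, exists_eq_right] at ha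
    obtain ⟨b, ⟨-, hb⟩, rfl⟩ := ha
    have h3 : 0 < 3 ^ m := by positivity
    have hb' := two_mul_add_three_le hb
    rw [add_comm, Nat.add_mul_div_right _ _ h3]
    have : b / 3 ^ m < 2 := by rw [Nat.div_lt_iff_lt_mul h3]; omega
    simp only [Finset.mem_insert, Finset.mem_singleton]
    generalize b / 3 ^ m = q at this ⊢
    omega
  calc _ ≤ ∑ x ∈ (values n ×ˢ values m).filter (fun x => x.1 * 3 ^ m + x.2 = c),
        mass p (n + m) c ^ t := by
        refine Finset.sum_le_sum fun x hx => ?_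
        rw [← Real.mul_rpow (mass_nonneg hp _ _) (mass_nonneg hp _ _)]
        rw [← (Finset.mem_filter.1 hx).2]
        exact Real.rpow_le_rpow (mul_nonneg (mass_nonneg hp _ _) (mass_nonneg hp _ _))
          (mass_mul_mass_le hp _ _ _ _) ht
    _ ≤ 2 * mass p (n + m) c ^ t := by
        rw [Finset.sum_const, nsmul_eq_mul]
        exact mul_le_mul_of_nonneg_right (by exact_mod_cast hcard)
          (Real.rpow_nonneg (mass_nonneg hp _ _) _)

variable (hs : ∑ i, p i = 1)

omit hp in
lemma partition_zero_right (n : ℕ) : partition p n 0 = (values n).card := by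
  simp [partition]

include hs

omit hp in
lemma sum_wordProb (n : ℕ) : ∑ w : Fin n → Fin 3, wordProb p w = 1 := by
  have := Finset.prod_univ_sum (fun _ : Fin n => (Finset.univ : Finset (Fin 3)))
    (fun _ j => p j)
  simp only [hs, Finset.prod_const_one, Fintype.piFinset_univ] at this
  exact this.symm

omit hp in
lemma sum_mass (n : ℕ) : ∑ a ∈ values n, mass p n a = 1 := by
  rw [← sum_wordProb hs n]
  exact Finset.sum_fiberwise_of_maps_to (fun w _ => val_mem_values w) _

lemma mass_le_one {n a : ℕ} : mass p n a ≤ 1 := by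
  rw [← sum_wordProb hs n]
  exact Finset.sum_le_sum_of_subset_of_nonneg (Finset.filter_subset _ _)
    fun w _ _ => (wordProb_pos hp w).le

lemma partition_le_pow (n : ℕ) {t : ℝ} (ht : 0 ≤ t) : partition p n t ≤ 3 ^ n := by
  calc partition p n t ≤ ∑ a ∈ values n, (1 : ℝ) :=
        Finset.sum_le_sum fun a _ =>
          Real.rpow_le_one (mass_nonneg hp _ _) (mass_le_one hp hs) ht
    _ ≤ 3 ^ n := by
        rw [Finset.sum_const, nsmul_eq_mul, mul_one]
        exact_mod_cast card_values_le n

lemma partition_antitone (n : ℕ) {s t : ℝ} (hst : s ≤ t) : partition p n t ≤ partition p n s :=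
  Finset.sum_le_sum fun _ ha =>
    Real.rpow_le_rpow_of_exponent_ge (mass_pos hp ha) (mass_le_one hp hs) hst

-- Every mass of level `n` is at least `c ^ n`, which bounds the loss when the exponent grows from
-- `s` to `t`; this yields the Lipschitz bound for the pressure.
omit hs in
lemma pow_rpow_mul_partition_le {c : ℝ} (hc : 0 < c) (hcp : ∀ i, c ≤ p i) (n : ℕ) {s t : ℝ}
    (hst : s ≤ t) : (c ^ n) ^ (t - s) * partition p n s ≤ partition p n t := by
  rw [partition, partition, Finset.mul_sum]
  refine Finset.sum_le_sum fun a ha => ?_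
  have hm := mass_pos hp ha
  calc (c ^ n) ^ (t - s) * mass p n a ^ s
      ≤ mass p n a ^ (t - s) * mass p n a ^ s :=
        mul_le_mul_of_nonneg_right (Real.rpow_le_rpow (by positivity)
          (pow_le_mass hp hc.le hcp ha) (by linarith)) (by positivity)
    _ = mass p n a ^ t := by rw [← Real.rpow_add hm]; simp

end

/-! ### The pressure -/

section

variable {p : Fin 3 → ℝ} (hp : ∀ i, 0 < p i) (hs : ∑ i, p i = 1)

include hp hs

/-- Fekete's lemma applied to `log 2 - log Z_n`; the summand `log 2` absorbs the factor 2 and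
vanishes after division by `n`. -/
lemma exists_tendsto_log_partition_div {t : ℝ} (ht : 0 ≤ t) :
    ∃ l, Tendsto (fun n : ℕ => Real.log (partition p n t) / n) atTop (𝓝 l) := by
  have hsub : Subadditive fun n => Real.log 2 - Real.log (partition p n t) := by
    intro m n
    have h := Real.log_le_log (mul_pos (partition_pos hp m t) (partition_pos hp n t))
      (partition_mul_le hp m n ht)
    rw [Real.log_mul (partition_pos hp m t).ne' (partition_pos hp n t).ne',
      Real.log_mul two_ne_zero (partition_pos hp _ t).ne'] at h
    linarith
  have hbdd : BddBelow (Set.range fun n : ℕ =>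
      (Real.log 2 - Real.log (partition p n t)) / n) := by
    refine ⟨-Real.log 3, ?_⟩
    rintro _ ⟨n, rfl⟩
    rcases Nat.eq_zero_or_pos n with rfl | hn
    · simpa using Real.log_nonneg (by norm_num)
    have hn' : (0 : ℝ) < n := by exact_mod_cast hn
    have h := Real.log_le_log (partition_pos hp n t) (partition_le_pow hp hs n ht)
    rw [Real.log_pow] at h
    have h2 := Real.log_nonneg (one_le_two (α := ℝ))
    change -Real.log 3 ≤ _ / _
    rw [le_div_iff₀ hn']
    linarith
  refine ⟨-hsub.lim, ?_⟩
  have h1 := (hsub.tendsto_lim hbdd).neg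
  have h2 : Tendsto (fun n : ℕ => Real.log 2 / n) atTop (𝓝 0) :=
    tendsto_const_div_atTop_nhds_zero_nat _
  have h3 := h2.add h1
  rw [zero_add] at h3
  refine h3.congr fun n => ?_
  ring

variable {a b : Fin 3} (hab : (a = 0 ∧ b = 2) ∨ (a = 1 ∧ b = 0))

include hab

lemma tendsto_pressureSeq {t : ℝ} (ht : 0 ≤ t) :
    Tendsto (pressureSeq p a b t) atTop (𝓝 (pressure p a b t)) := by
  obtain ⟨l, hl⟩ := exists_tendsto_log_partition_div hp hs ht
  have h : Tendsto (pressureSeq p a b t) atTop (𝓝 l) :=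
    hl.congr fun n => by rw [pressureSeq_eq p hab]; ring
  rwa [pressure, h.limsup_eq]

lemma tendsto_log_partition_div {t : ℝ} (ht : 0 ≤ t) :
    Tendsto (fun n : ℕ => Real.log (partition p n t) / n) atTop (𝓝 (pressure p a b t)) :=
  (tendsto_pressureSeq hp hs hab ht).congr fun n => by rw [pressureSeq_eq p hab]; ring

lemma pressure_antitone {s t : ℝ} (h0 : 0 ≤ s) (hst : s ≤ t) :
    pressure p a b t ≤ pressure p a b s := by
  refine le_of_tendsto_of_tendsto' (tendsto_log_partition_div hp hs hab (h0.trans hst))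
    (tendsto_log_partition_div hp hs hab h0) fun n => ?_
  exact div_le_div_of_nonneg_right
    (Real.log_le_log (partition_pos hp n t) (partition_antitone hp hs n hst)) n.cast_nonneg

lemma exists_pressure_lipschitz :
    ∃ K : ℝ, ∀ s t, 0 ≤ s → s ≤ t → pressure p a b s ≤ pressure p a b t + K * (t - s) := by
  obtain ⟨i, -, hi⟩ := Finset.exists_min_image Finset.univ p Finset.univ_nonempty
  refine ⟨-Real.log (p i), fun s t h0 hst => ?_⟩
  have h := (tendsto_log_partition_div hp hs hab (h0.trans hst)).add_const
    (-Real.log (p i) * (t - s))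
  refine le_of_tendsto_of_tendsto (tendsto_log_partition_div hp hs hab h0) h ?_
  filter_upwards [eventually_gt_atTop 0] with n hn
  have hn' : (0 : ℝ) < n := by exact_mod_cast hn
  have hl := Real.log_le_log (mul_pos (Real.rpow_pos_of_pos (pow_pos (hp i) n) _)
    (partition_pos hp n s))
    (pow_rpow_mul_partition_le hp (hp i) (fun j => hi j (Finset.mem_univ j)) n hst)
  rw [Real.log_mul (Real.rpow_pos_of_pos (pow_pos (hp i) n) _).ne' (partition_pos hp n s).ne',
    Real.log_rpow (pow_pos (hp i) n), Real.log_pow] at hl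
  rw [div_le_iff₀ hn', add_mul, div_mul_cancel₀ _ hn'.ne']
  linarith

lemma pressure_one : pressure p a b 1 = 0 := by
  refine tendsto_nhds_unique (tendsto_log_partition_div hp hs hab zero_le_one) ?_
  simp [partition, sum_mass hs]

lemma log_two_le_pressure_zero : Real.log 2 ≤ pressure p a b 0 := by
  refine ge_of_tendsto (tendsto_log_partition_div hp hs hab le_rfl) ?_
  filter_upwards [eventually_gt_atTop 0] with n hn
  have hn' : (0 : ℝ) < n := by exact_mod_cast hn
  rw [le_div_iff₀ hn', partition_zero_right, mul_comm, ← Real.log_pow]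
  exact Real.log_le_log (by positivity) (by exact_mod_cast two_pow_le_card_values n)

lemma exists_pressure_eq {r : ℝ} (hr : 0 < r) :
    ∃ t₀ : ℝ, (0 < t₀ ∧ t₀ < 1) ∧ pressure p a b t₀ = r * t₀ * Real.log 3 := by
  obtain ⟨K, hK⟩ := exists_pressure_lipschitz hp hs hab
  have hanti := fun {s t} => pressure_antitone (s := s) (t := t) hp hs hab
  have hcont : ContinuousOn (pressure p a b) (Set.Icc 0 1) := by
    have hlip : LipschitzOnWith (Real.toNNReal K) (pressure p a b) (Set.Icc 0 1) := by
      refine LipschitzOnWith.of_le_add_mul _ fun s hs t ht => ?_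
      have hKK := Real.le_coe_toNNReal K
      rcases le_total s t with hst | hts
      · have := hK s t hs.1 hst
        rw [Real.dist_eq, abs_sub_comm, abs_of_nonneg (by linarith)]
        nlinarith
      · have := hanti ht.1 hts
        have h2 : 0 ≤ (Real.toNNReal K : ℝ) * dist s t := by positivity
        linarith
    exact hlip.continuousOn
  have h3 : 0 < Real.log 3 := Real.log_pos (by norm_num)
  have hc2 : ContinuousOn (fun t => pressure p a b t - r * t * Real.log 3) (Set.Icc 0 1) :=
    hcont.sub (by fun_prop)
  have hmem := intermediate_value_Ioo' zero_le_one hc2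
  have h0 := log_two_le_pressure_zero hp hs hab
  have h2 : 0 < Real.log 2 := Real.log_pos (by norm_num)
  obtain ⟨t, ht, h⟩ := hmem (show (0 : ℝ) ∈ _ by
    simp only [pressure_one hp hs hab]
    constructor
    · have := mul_pos hr h3; linarith
    · simp; linarith)
  exact ⟨t, ht, sub_eq_zero.1 h⟩

lemma lt_pressure_of_lt {r s t : ℝ} (hr : 0 < r) (h0 : 0 ≤ s) (hst : s < t)
    (ht : pressure p a b t = r * t * Real.log 3) : r * s * Real.log 3 < pressure p a b s := by
  have h3 : 0 < Real.log 3 := Real.log_pos (by norm_num)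
  have := pressure_antitone hp hs hab h0 hst.le
  have := mul_lt_mul_of_pos_right (mul_lt_mul_of_pos_left hst hr) h3
  linarith

lemma pressure_lt_of_lt {r s t : ℝ} (hr : 0 < r) (h0 : 0 ≤ t) (hst : t < s)
    (ht : pressure p a b t = r * t * Real.log 3) : pressure p a b s < r * s * Real.log 3 := by
  have h3 : 0 < Real.log 3 := Real.log_pos (by norm_num)
  have := pressure_antitone hp hs hab h0 hst.le
  have := mul_lt_mul_of_pos_right (mul_lt_mul_of_pos_left hst hr) h3
  linarith

end

/-! ### The coding measure and the natural projection -/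

/-- The value of the prefix of length `n` of an infinite word. -/
def code (n : ℕ) (ω : ℕ → Fin 3) : ℕ := val fun k : Fin n => ω k

lemma code_mem_values (n : ℕ) (ω : ℕ → Fin 3) : code n ω ∈ values n := val_mem_values _

lemma code_succ (n : ℕ) (ω : ℕ → Fin 3) : code (n + 1) ω = 3 * code n ω + natDigit (ω n) := by
  rw [code, code, ← val_snoc]
  congr 1
  funext k
  induction k using Fin.lastCases with
  | last => simp
  | cast k => simp

lemma digit_mem_Icc (i : Fin 3) : digit i ∈ Set.Icc (0 : ℝ) 3 := by
  rw [digit_eq]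
  exact ⟨by positivity, by exact_mod_cast natDigit_le i⟩

lemma summable_three_mul_inv_pow : Summable fun k : ℕ => (3 : ℝ) * (3 ^ k)⁻¹ := by
  simp_rw [← inv_pow]
  exact (summable_geometric_of_lt_one (by norm_num) (by norm_num)).mul_left _

lemma digit_mul_le (i : Fin 3) (k : ℕ) : digit i * ((3 : ℝ) ^ k)⁻¹ ≤ 3 * (3 ^ k)⁻¹ :=
  mul_le_mul_of_nonneg_right (digit_mem_Icc i).2 (by positivity)

lemma digit_mul_nonneg (i : Fin 3) (k : ℕ) : 0 ≤ digit i * ((3 : ℝ) ^ k)⁻¹ :=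
  mul_nonneg (digit_mem_Icc i).1 (by positivity)

lemma summable_proj (ω : ℕ → Fin 3) : Summable fun k : ℕ => digit (ω k) * ((3 : ℝ) ^ k)⁻¹ :=
  .of_nonneg_of_le (fun k => digit_mul_nonneg _ k) (fun k => digit_mul_le _ k)
    summable_three_mul_inv_pow

lemma proj_nonneg (ω : ℕ → Fin 3) : 0 ≤ proj ω := tsum_nonneg fun k => digit_mul_nonneg _ k

lemma proj_le (ω : ℕ → Fin 3) : proj ω ≤ 9 / 2 := by
  calc proj ω ≤ ∑' k : ℕ, (3 : ℝ) * (3 ^ k)⁻¹ :=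
        (summable_proj ω).tsum_le_tsum (fun k => digit_mul_le _ k) summable_three_mul_inv_pow
    _ = 9 / 2 := by
        simp_rw [← inv_pow]
        rw [tsum_mul_left, tsum_geometric_of_lt_one (by norm_num) (by norm_num)]
        norm_num

lemma sum_range_digit (n : ℕ) (ω : ℕ → Fin 3) :
    ∑ k ∈ Finset.range n, digit (ω k) * ((3 : ℝ) ^ k)⁻¹ = 3 * code n ω / 3 ^ n := by
  induction n with
  | zero => simp [code, val_zero]
  | succ n ih =>
    rw [Finset.sum_range_succ, ih, code_succ, digit_eq]
    push_cast
    field_simp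
    ring

lemma proj_eq (n : ℕ) (ω : ℕ → Fin 3) :
    proj ω = 3 * code n ω / 3 ^ n + proj (fun k => ω (k + n)) / 3 ^ n := by
  rw [proj, ← (summable_proj ω).sum_add_tsum_nat_add n, sum_range_digit, proj, ← tsum_div_const]
  congr 1
  refine tsum_congr fun k => ?_
  rw [pow_add]
  field_simp

lemma measurable_proj : Measurable proj := by
  refine measurable_of_tendsto_metrizable (f := fun n ω => ∑ k ∈ Finset.range n,
    digit (ω k) * ((3 : ℝ) ^ k)⁻¹) (fun n => ?_) ?_
  · refine Finset.measurable_sum _ fun k _ => Measurable.mul_const ?_ _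
    exact (measurable_of_finite digit).comp (measurable_pi_apply k)
  · rw [tendsto_pi_nhds]
    exact fun ω => (summable_proj ω).hasSum.tendsto_sum_nat

lemma measurableSet_code_eq (n a : ℕ) : MeasurableSet {ω | code n ω = a} := by
  have h : Measurable fun (ω : ℕ → Fin 3) (k : Fin n) => ω k :=
    measurable_pi_lambda _ fun k => measurable_pi_apply _
  exact h (MeasurableSet.of_discrete (s := {w : Fin n → Fin 3 | val w = a}))

lemma letterMeasure_singleton (p : Fin 3 → ℝ) (i : Fin 3) :
    letterMeasure p {i} = ENNReal.ofReal (p i) := by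
  simp [letterMeasure, Set.indicator_apply]

section

variable {p : Fin 3 → ℝ} (hp : ∀ i, 0 < p i) (hs : ∑ i, p i = 1)

include hp hs

lemma isProbabilityMeasure_letterMeasure : IsProbabilityMeasure (letterMeasure p) := by
  constructor
  simp only [letterMeasure, Measure.coe_finsetSum, Finset.sum_apply, Measure.smul_apply,
    measure_univ, smul_eq_mul, mul_one]
  rw [← ENNReal.ofReal_sum_of_nonneg fun i _ => (hp i).le, hs, ENNReal.ofReal_one]

lemma infinitePi_prefix_eq {n : ℕ} (w : Fin n → Fin 3) :
    Measure.infinitePi (fun _ : ℕ => letterMeasure p) ((fun ω (k : Fin n) => ω k) ⁻¹' {w}) =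
      ENNReal.ofReal (wordProb p w) := by
  have := isProbabilityMeasure_letterMeasure hp hs
  have hset : ((fun (ω : ℕ → Fin 3) (k : Fin n) => ω k) ⁻¹' {w}) =
      Set.pi (Finset.range n) fun i => if h : i < n then {w ⟨i, h⟩} else Set.univ := by
    ext ω
    simp only [Set.mem_preimage, Set.mem_singleton_iff, Set.mem_pi, Finset.coe_range, Set.mem_Iio]
    constructor
    · rintro rfl i hi
      simp [hi]
    · intro h
      funext k
      simpa using h k k.2
  rw [hset, Measure.infinitePi_pi _ fun _ _ => MeasurableSet.of_discrete, Finset.prod_range,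
    wordProb, ENNReal.ofReal_prod_of_nonneg fun k _ => (hp _).le]
  refine Finset.prod_congr rfl fun k _ => ?_
  simp [letterMeasure_singleton]

lemma infinitePi_code_eq (n a : ℕ) :
    Measure.infinitePi (fun _ : ℕ => letterMeasure p) {ω | code n ω = a} =
      ENNReal.ofReal (mass p n a) := by
  have h : Measurable fun (ω : ℕ → Fin 3) (k : Fin n) => ω k :=
    measurable_pi_lambda _ fun k => measurable_pi_apply _
  have hsum := sum_measure_preimage_singleton
    (μ := Measure.infinitePi (fun _ : ℕ => letterMeasure p))
    (Finset.univ.filter fun w : Fin n → Fin 3 => val w = a)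
    (f := fun (ω : ℕ → Fin 3) (k : Fin n) => ω k) fun w _ => h MeasurableSet.of_discrete
  rw [mass, ENNReal.ofReal_sum_of_nonneg fun w _ => (wordProb_pos hp w).le]
  simp_rw [← infinitePi_prefix_eq hp hs]
  rw [hsum]
  congr 1
  ext ω
  simp [code]

/-! ### Quantization error from covers and from separated cells -/

omit hp hs in
lemma measurable_infDist_rpow (r : ℝ) (α : Finset ℝ) :
    Measurable fun x : ℝ => ENNReal.ofReal (Metric.infDist x (α : Set ℝ) ^ r) :=
  (measurable_infDist.pow_const r).ennreal_ofReal

omit hp hs in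
lemma lintegral_selfSimilarMeasure (r : ℝ) (α : Finset ℝ) :
    ∫⁻ x, ENNReal.ofReal (Metric.infDist x (α : Set ℝ) ^ r) ∂selfSimilarMeasure p =
      ∫⁻ ω, ENNReal.ofReal (Metric.infDist (proj ω) (α : Set ℝ) ^ r)
        ∂Measure.infinitePi (fun _ : ℕ => letterMeasure p) := by
  rw [selfSimilarMeasure, lintegral_map (measurable_infDist_rpow r α) measurable_proj]

/-- The code consists of the left ends of the cells; a point of a cell of level `n` lies at most
`9/2 · 3^{-n}` to the right of it. -/
lemma quantizationError_le_of_cover {r : ℝ} (hr : 0 ≤ r) {Γ : Finset (ℕ × ℕ)}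
    (hΓ : ∀ ω, ∃ x ∈ Γ, code x.1 ω = x.2) {N : ℕ} (hN : Γ.card ≤ N) :
    quantizationError (selfSimilarMeasure p) r N ≤
      ∑ x ∈ Γ, ENNReal.ofReal (mass p x.1 x.2 * (9 / 2 / 3 ^ x.1) ^ r) := by
  classical
  set α : Finset ℝ := Γ.image fun x => 3 * (x.2 : ℝ) / 3 ^ x.1 with hα
  have hcard : 1 ≤ α.card ∧ α.card ≤ N := by
    refine ⟨?_, Finset.card_image_le.trans hN⟩
    obtain ⟨x, hx, -⟩ := hΓ fun _ => 0
    exact Finset.card_pos.2 ⟨_, Finset.mem_image_of_mem _ hx⟩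
  refine (iInf₂_le α hcard).trans ?_
  rw [lintegral_selfSimilarMeasure]
  calc _ ≤ ∫⁻ ω, ∑ x ∈ Γ, {ω | code x.1 ω = x.2}.indicator
          (fun _ => ENNReal.ofReal ((9 / 2 / 3 ^ x.1) ^ r)) ω
          ∂Measure.infinitePi (fun _ : ℕ => letterMeasure p) := by
        refine lintegral_mono fun ω => ?_
        obtain ⟨x, hx, hxω⟩ := hΓ ω
        refine le_trans ?_ (Finset.single_le_sum (fun _ _ => zero_le) hx)
        rw [Set.indicator_of_mem (by exact hxω)]
        refine ENNReal.ofReal_le_ofReal (Real.rpow_le_rpow Metric.infDist_nonneg ?_ hr)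
        refine (Metric.infDist_le_dist_of_mem (y := 3 * (x.2 : ℝ) / 3 ^ x.1) ?_).trans ?_
        · exact Finset.mem_coe.2
            (Finset.mem_image_of_mem (fun x : ℕ × ℕ => 3 * (x.2 : ℝ) / 3 ^ x.1) hx)
        · rw [proj_eq x.1, hxω, Real.dist_eq, add_sub_cancel_left, abs_of_nonneg
            (div_nonneg (proj_nonneg _) (by positivity))]
          exact div_le_div_of_nonneg_right (proj_le _) (by positivity)
    _ = _ := by
        rw [lintegral_finsetSum _ fun x _ =>
          measurable_const.indicator (measurableSet_code_eq x.1 x.2)]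
        refine Finset.sum_congr rfl fun x _ => ?_
        rw [lintegral_indicator_const (measurableSet_code_eq x.1 x.2),
          infinitePi_code_eq hp hs, mul_comm, ENNReal.ofReal_mul (mass_nonneg hp _ _)]

/-- Each point of `α` is near at most one cell of `G`, so at least `N` cells keep distance `3 / 3 ^
n` from `α`. -/
lemma le_quantizationError_of_separated {r : ℝ} (hr : 0 ≤ r) {n : ℕ} {G : Finset ℕ}
    (hsep : ∀ a ∈ G, ∀ b ∈ G, a < b → a + 4 ≤ b) {c : ℝ} (hc : ∀ a ∈ G, c ≤ mass p n a)
    {N : ℕ} (hN : 2 * N ≤ G.card) :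
    ENNReal.ofReal (N * (c * (3 / 3 ^ n) ^ r)) ≤
      quantizationError (selfSimilarMeasure p) r N := by
  classical
  refine le_iInf₂ fun α hα => ?_
  rw [lintegral_selfSimilarMeasure]
  -- The cell lies in `[3a, 3a + 9/2] / 3 ^ n`, here widened by `3 / 3 ^ n` on both sides. Widened
  -- cells are disjoint once the values differ by 4.
  let near : ℕ → ℝ → Prop := fun a y =>
    3 * ((a : ℝ) - 1) / 3 ^ n < y ∧ y < 3 * ((a : ℝ) + 5 / 2) / 3 ^ n
  have h3 : (0 : ℝ) < 3 ^ n := by positivity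
  have hsub : ∀ a ∈ G, ∀ b ∈ G, ∀ y, near a y → near b y → ¬ a < b := by
    intro a ha b hb y hay hby hab
    have h1 : (a : ℝ) + 4 ≤ b := by exact_mod_cast hsep a ha b hb hab
    have h2 := hby.1.trans hay.2
    rw [div_lt_div_iff_of_pos_right h3] at h2
    linarith
  have hhit : (G.filter fun a => ∃ y ∈ α, near a y).card ≤ α.card := by
    refine Finset.card_le_card_of_forall_subsingleton near (fun a ha => ?_) fun y _ => ?_
    · obtain ⟨y, hy, h⟩ := (Finset.mem_filter.1 ha).2
      exact ⟨y, hy, h⟩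
    · rintro a ⟨ha, hay⟩ b ⟨hb, hby⟩
      have ha' := (Finset.mem_filter.1 ha).1
      have hb' := (Finset.mem_filter.1 hb).1
      exact le_antisymm (not_lt.1 (hsub b hb' a ha' y hby hay))
        (not_lt.1 (hsub a ha' b hb' y hay hby))
  set F := G.filter fun a => ¬∃ y ∈ α, near a y with hF
  have hFcard : N ≤ F.card := by
    have := Finset.card_filter_add_card_filter_not (s := G) fun a => ∃ y ∈ α, near a y
    have := hα.2
    rw [hF]
    omega
  calc ENNReal.ofReal (N * (c * (3 / 3 ^ n) ^ r))
      = N * ENNReal.ofReal (c * (3 / 3 ^ n) ^ r) := by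
        rw [ENNReal.ofReal_mul N.cast_nonneg, ENNReal.ofReal_natCast]
    _ ≤ F.card * ENNReal.ofReal (c * (3 / 3 ^ n) ^ r) := by gcongr
    _ = ∑ a ∈ F, ENNReal.ofReal (c * (3 / 3 ^ n) ^ r) := by simp
    _ ≤ ∑ a ∈ F, ENNReal.ofReal (mass p n a * (3 / 3 ^ n) ^ r) := by
        refine Finset.sum_le_sum fun a ha => ENNReal.ofReal_le_ofReal ?_
        exact mul_le_mul_of_nonneg_right (hc a (Finset.mem_filter.1 ha).1) (by positivity)
    _ = ∫⁻ ω, ∑ a ∈ F, {ω | code n ω = a}.indicator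
          (fun _ => ENNReal.ofReal ((3 / 3 ^ n) ^ r)) ω
          ∂Measure.infinitePi (fun _ : ℕ => letterMeasure p) := by
        rw [lintegral_finsetSum _ fun a _ =>
          measurable_const.indicator (measurableSet_code_eq n a)]
        refine Finset.sum_congr rfl fun a _ => ?_
        rw [lintegral_indicator_const (measurableSet_code_eq n a),
          infinitePi_code_eq hp hs, ENNReal.ofReal_mul (mass_nonneg hp _ _),
          mul_comm]
    _ ≤ _ := by
        refine lintegral_mono fun ω => ?_
        have hind : ∀ a, {ω | code n ω = a}.indicator
            (fun _ => ENNReal.ofReal ((3 / 3 ^ n) ^ r)) ω =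
            if code n ω = a then ENNReal.ofReal ((3 / 3 ^ n) ^ r) else 0 := fun a => by
          simp [Set.indicator_apply]
        simp only [hind, Finset.sum_ite_eq]
        split_ifs with hω
        · refine ENNReal.ofReal_le_ofReal (Real.rpow_le_rpow (by positivity) ?_ hr)
          rw [Metric.le_infDist (by exact_mod_cast Finset.card_pos.1 hα.1)]
          intro y hy
          have hy' := not_and_or.1 fun h => (Finset.mem_filter.1 hω).2 ⟨y, hy, h⟩
          have hω0 := proj_nonneg fun k => ω (k + n)
          have hω1 := proj_le fun k => ω (k + n)
          rw [proj_eq n, Real.dist_eq, ← add_div]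
          rcases hy' with hy' | hy'
          · rw [not_lt, le_div_iff₀ h3] at hy'
            refine le_trans ?_ (le_abs_self _)
            rw [div_le_iff₀ h3, sub_mul, div_mul_cancel₀ _ h3.ne']
            linarith
          · rw [not_lt, div_le_iff₀ h3] at hy'
            refine le_trans ?_ (neg_le_abs _)
            rw [div_le_iff₀ h3, neg_sub, sub_mul, div_mul_cancel₀ _ h3.ne']
            linarith
        · exact zero_le

end

/-! ### Bounds for the quantization error -/

/-- The contribution of a cell of level `n` to the quantization error, up to a constant. -/
def weight (p : Fin 3 → ℝ) (r : ℝ) (n a : ℕ) : ℝ := mass p n a / (3 ^ n) ^ r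

section

variable {p : Fin 3 → ℝ} (hp : ∀ i, 0 < p i) (hs : ∑ i, p i = 1)

omit hp hs in
lemma three_pow_rpow_pos (n : ℕ) (r : ℝ) : 0 < ((3 : ℝ) ^ n) ^ r := by positivity

omit hp hs in
lemma mass_mul_div_rpow {r c : ℝ} (hc : 0 ≤ c) (n a : ℕ) :
    mass p n a * (c / 3 ^ n) ^ r = c ^ r * weight p r n a := by
  rw [weight, Real.div_rpow hc (by positivity)]
  ring

include hp

lemma weight_nonneg (r : ℝ) (n a : ℕ) : 0 ≤ weight p r n a :=
  div_nonneg (mass_nonneg hp n a) (three_pow_rpow_pos n r).le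

lemma weight_pos (r : ℝ) {n a : ℕ} (ha : a ∈ values n) : 0 < weight p r n a :=
  div_pos (mass_pos hp ha) (three_pow_rpow_pos n r)

lemma sum_weight_rpow (r t : ℝ) (n : ℕ) :
    ∑ a ∈ values n, weight p r n a ^ t = partition p n t / (3 ^ n) ^ (r * t) := by
  rw [partition, Finset.sum_div]
  refine Finset.sum_congr rfl fun a _ => ?_
  rw [weight, Real.div_rpow (mass_nonneg hp n a) (three_pow_rpow_pos n r).le,
    ← Real.rpow_mul (by positivity)]

lemma weight_mul_weight_le (r : ℝ) (n m a b : ℕ) :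
    weight p r n a * weight p r m b ≤ weight p r (n + m) (a * 3 ^ m + b) := by
  rw [weight, weight, weight, div_mul_div_comm, ← Real.mul_rpow (by positivity) (by positivity),
    ← pow_add]
  exact div_le_div_of_nonneg_right (mass_mul_mass_le hp n m a b) (three_pow_rpow_pos _ r).le

include hs

omit hp in
lemma weight_zero (r : ℝ) : weight p r 0 0 = 1 := by
  have := sum_mass hs 0
  rw [values_zero, Finset.sum_singleton] at this
  simp [weight, this]

lemma weight_le (r : ℝ) (n a : ℕ) : weight p r n a ≤ ((3 ^ r)⁻¹) ^ n := by
  rw [weight, inv_pow, ← Real.rpow_natCast_mul (by norm_num), ← Real.rpow_mul_natCast (by norm_num),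
    mul_comm r, ← one_div]
  exact div_le_div_of_nonneg_right (mass_le_one hp hs) (by positivity)

omit hp hs in
lemma tendsto_weight_bound {r : ℝ} (hr : 0 < r) :
    Tendsto (fun n : ℕ => (((3 : ℝ) ^ r)⁻¹) ^ n) atTop (𝓝 0) :=
  tendsto_pow_atTop_nhds_zero_of_lt_one (by positivity)
    (inv_lt_one_of_one_lt₀ (Real.one_lt_rpow (by norm_num) hr))

lemma weight_le_one {r : ℝ} (hr : 0 ≤ r) (n a : ℕ) : weight p r n a ≤ 1 :=
  (weight_le hp hs r n a).trans (pow_le_one₀ (by positivity)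
    (inv_le_one_of_one_le₀ (Real.one_le_rpow (by norm_num) hr)))

/-- The cells at which the weight first drops below `ε` give a code with few points. -/
lemma quantizationError_le_of_summable {r t : ℝ} (hr : 0 < r)
    (hsum : Summable fun n => ∑ a ∈ values n, weight p r n a ^ t) {ε : ℝ} (hε : 0 < ε)
    (hε1 : ε ≤ 1) (ht : 0 ≤ t) {N : ℕ}
    (hN : 3 * ((∑' n, ∑ a ∈ values n, weight p r n a ^ t) / ε ^ t) ≤ N) :
    quantizationError (selfSimilarMeasure p) r N ≤ ENNReal.ofReal (N * ((9 / 2) ^ r * ε)) := by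
  classical
  obtain ⟨M, hM⟩ := eventually_atTop.1 ((tendsto_weight_bound hr).eventually_lt_const hε)
  -- Cells of weight at least `ε`, all of level below `M`; a Markov estimate bounds their number.
  set B := (Finset.range M).sigma fun n => (values n).filter fun a => ε ≤ weight p r n a with hB
  have hBcard : (B.card : ℝ) ≤ (∑' n, ∑ a ∈ values n, weight p r n a ^ t) / ε ^ t := by
    rw [le_div_iff₀ (by positivity)]
    calc (B.card : ℝ) * ε ^ t = ∑ x ∈ B, ε ^ t := by simp
      _ ≤ ∑ x ∈ B, weight p r x.1 x.2 ^ t := by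
          refine Finset.sum_le_sum fun x hx => Real.rpow_le_rpow hε.le ?_ ht
          rw [hB, Finset.mem_sigma, Finset.mem_filter] at hx
          exact hx.2.2
      _ = ∑ n ∈ Finset.range M, ∑ a ∈ (values n).filter fun a => ε ≤ weight p r n a,
            weight p r n a ^ t := Finset.sum_sigma _ _ _
      _ ≤ ∑ n ∈ Finset.range M, ∑ a ∈ values n, weight p r n a ^ t :=
          Finset.sum_le_sum fun n _ => Finset.sum_le_sum_of_subset_of_nonneg
            (Finset.filter_subset _ _) fun a _ _ => Real.rpow_nonneg (weight_nonneg hp _ _ _) _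
      _ ≤ _ := hsum.sum_le_tsum _ fun n _ => Finset.sum_nonneg
          fun a _ => Real.rpow_nonneg (weight_nonneg hp _ _ _) _
  -- Stopping cells: children of cells in `B` that are themselves lighter than `ε`.
  set Γ := ((B ×ˢ (Finset.univ : Finset (Fin 3))).image fun y =>
    (y.1.1 + 1, 3 * y.1.2 + natDigit y.2)).filter fun x => weight p r x.1 x.2 < ε with hΓ
  have hΓcard : Γ.card ≤ N := by
    have h1 : Γ.card ≤ B.card * 3 := by
      refine (Finset.card_filter_le _ _).trans (Finset.card_image_le.trans ?_)
      simp [Finset.card_product]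
    have h2 : ((B.card * 3 : ℕ) : ℝ) ≤ N := by push_cast; linarith
    exact h1.trans (by exact_mod_cast h2)
  have hcover : ∀ ω, ∃ x ∈ Γ, code x.1 ω = x.2 := by
    intro ω
    have hex : ∃ n, weight p r n (code n ω) < ε :=
      ⟨M, (weight_le hp hs r _ _).trans_lt (hM M le_rfl)⟩
    -- The stopping level is positive because the root has weight `1 ≥ ε`.
    obtain ⟨k, hk⟩ : ∃ k, Nat.find hex = k + 1 := by
      refine Nat.exists_eq_succ_of_ne_zero fun h0 => ?_
      have := (Nat.find_eq_zero hex).1 h0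
      rw [show code 0 ω = 0 from val_zero _, weight_zero hs] at this
      linarith
    have hlt : weight p r (k + 1) (code (k + 1) ω) < ε := hk ▸ Nat.find_spec hex
    have hge : ε ≤ weight p r k (code k ω) := not_lt.1 (Nat.find_min hex (by omega))
    refine ⟨(k + 1, code (k + 1) ω), ?_, rfl⟩
    rw [hΓ, Finset.mem_filter]
    refine ⟨Finset.mem_image.2 ⟨(⟨k, code k ω⟩, ω k), ?_, ?_⟩, hlt⟩
    · rw [Finset.mem_product, hB, Finset.mem_sigma, Finset.mem_filter, Finset.mem_range]
      refine ⟨⟨?_, code_mem_values _ _, hge⟩, Finset.mem_univ _⟩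
      by_contra hkM
      exact absurd ((weight_le hp hs r k _).trans_lt (hM k (not_lt.1 hkM))) (not_lt.2 hge)
    · rw [code_succ]
  refine (quantizationError_le_of_cover hp hs hr.le hcover hΓcard).trans ?_
  rw [← ENNReal.ofReal_sum_of_nonneg fun x _ => mul_nonneg (mass_nonneg hp _ _) (by positivity)]
  refine ENNReal.ofReal_le_ofReal ?_
  calc _ ≤ ∑ x ∈ Γ, (9 / 2 : ℝ) ^ r * ε := by
        refine Finset.sum_le_sum fun x hx => ?_
        rw [mass_mul_div_rpow (by norm_num)]
        rw [hΓ, Finset.mem_filter] at hx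
        exact mul_le_mul_of_nonneg_left hx.2.le (by positivity)
    _ = Γ.card * ((9 / 2 : ℝ) ^ r * ε) := by rw [Finset.sum_const, nsmul_eq_mul]
    _ ≤ _ := mul_le_mul_of_nonneg_right (by exact_mod_cast hΓcard) (by positivity)

lemma exists_quantizationError_le {r t : ℝ} (hr : 0 < r) (ht : 0 < t)
    (hsum : Summable fun n => ∑ a ∈ values n, weight p r n a ^ t) :
    ∃ C : ℝ, 0 < C ∧ ∀ᶠ N : ℕ in atTop, quantizationError (selfSimilarMeasure p) r N ≤
      ENNReal.ofReal (C * (N : ℝ) ^ (1 - 1 / t)) := by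
  set T := ∑' n, ∑ a ∈ values n, weight p r n a ^ t with hT
  have hT1 : 1 ≤ T := by
    refine le_trans (le_of_eq ?_) (hsum.le_tsum 0 fun n _ => Finset.sum_nonneg
      fun a _ => Real.rpow_nonneg (weight_nonneg hp _ _ _) _)
    simp [values_zero, weight_zero hs]
  refine ⟨(9 / 2) ^ r * (3 * T) ^ (1 / t), by positivity, ?_⟩
  filter_upwards [eventually_ge_atTop ⌈3 * T⌉₊] with N hN
  have hN : 3 * T ≤ N := Nat.ceil_le.1 hN
  have hN0 : (0 : ℝ) < N := by linarith
  -- This `ε` solves `3 T / ε ^ t = N`, and `N ≥ 3 T` ensures `ε ≤ 1`.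
  have h := quantizationError_le_of_summable hp hs hr hsum (ε := (3 * T / N) ^ (1 / t))
    (by positivity) (Real.rpow_le_one (by positivity) ((div_le_one hN0).2 hN) (by positivity))
    ht.le (N := N) (by
      rw [← Real.rpow_mul (by positivity), one_div_mul_cancel ht.ne', Real.rpow_one, ← hT]
      field_simp
      exact le_rfl)
  refine h.trans (le_of_eq ?_)
  rw [Real.div_rpow (by positivity) hN0.le, Real.rpow_sub hN0, Real.rpow_one]
  congr 1
  ring

omit hs in
/-- Concatenations of the words of a separated family form a separated family. -/
lemma exists_separated_pow {r s : ℝ} (hs0 : 0 ≤ s) {n : ℕ} {G : Finset ℕ} (hG : G ⊆ values n)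
    (hsep : ∀ a ∈ G, ∀ b ∈ G, a < b → a + 4 ≤ b) (hw : ∀ a ∈ G, s ≤ weight p r n a)
    (h1 : weight p r 0 0 = 1) (m : ℕ) :
    ∃ H ⊆ values (n * m), (∀ a ∈ H, ∀ b ∈ H, a < b → a + 4 ≤ b) ∧
      (∀ a ∈ H, s ^ m ≤ weight p r (n * m) a) ∧ H.card = G.card ^ m := by
  classical
  induction m with
  | zero => exact ⟨{0}, by simp [values_zero], by simp, by simp [h1], by simp⟩
  | succ m ih =>
    obtain ⟨H, hH, hHsep, hHw, hHcard⟩ := ih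
    -- Prefixes at least 4 apart stay separated after any continuation, because `4 · 3 ^ n` exceeds
    -- every value of level `n` by at least 4.
    have hlt : ∀ {a b a' b' : ℕ}, a ∈ H → b ∈ G → a' ∈ H → b' ∈ G → a < a' →
        a * 3 ^ n + b + 4 ≤ a' * 3 ^ n + b' := by
      intro a b a' b' ha hb ha' hb' haa
      have h2 := Nat.mul_le_mul_right (3 ^ n) (hHsep a ha a' ha' haa)
      have h3 := two_mul_add_three_le (hG hb)
      have h4 : 1 ≤ 3 ^ n := Nat.one_le_pow _ _ (by norm_num)
      rw [add_mul] at h2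
      omega
    refine ⟨(H ×ˢ G).image fun x => x.1 * 3 ^ n + x.2, ?_, ?_, ?_, ?_⟩
    · intro c hc
      obtain ⟨⟨a, b⟩, hab, rfl⟩ := Finset.mem_image.1 hc
      rw [Finset.mem_product] at hab
      exact mul_add_mem_values (hH hab.1) (hG hab.2)
    · simp only [Finset.mem_image, Finset.mem_product, Prod.exists]
      rintro _ ⟨a, b, ⟨ha, hb⟩, rfl⟩ _ ⟨a', b', ⟨ha', hb'⟩, rfl⟩ h
      rcases lt_trichotomy a a' with haa | rfl | haa
      · exact hlt ha hb ha' hb' haa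
      · have := hsep b hb b' hb' (by omega)
        omega
      · have := hlt ha' hb' ha hb haa
        omega
    · intro c hc
      obtain ⟨⟨a, b⟩, hab, rfl⟩ := Finset.mem_image.1 hc
      rw [Finset.mem_product] at hab
      rw [pow_succ]
      exact (mul_le_mul (hHw a hab.1) (hw b hab.2) hs0 (weight_nonneg hp _ _ _)).trans
        (weight_mul_weight_le hp r _ _ a b)
    · rw [Finset.card_image_of_injOn, Finset.card_product, hHcard, pow_succ]
      rintro ⟨a, b⟩ hab ⟨a', b'⟩ hab' h
      rw [Finset.mem_coe, Finset.mem_product] at hab hab'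
      have h : a * 3 ^ n + b = a' * 3 ^ n + b' := h
      rcases lt_trichotomy a a' with haa | rfl | haa
      · have : a * 3 ^ n + b + 4 ≤ a' * 3 ^ n + b' := hlt hab.1 hab.2 hab'.1 hab'.2 haa
        omega
      · rw [Nat.add_left_cancel h]
      · have : a' * 3 ^ n + b' + 4 ≤ a * 3 ^ n + b := hlt hab'.1 hab'.2 hab.1 hab.2 haa
        omega

/-- Take the least power `k + 1` with `2N ≤ |G| ^ (k + 1)`. Minimality gives `s ^ (-k t) ≤ |G| ^ k <
2N`, so the weights `s ^ (k + 1)` are at least `s (2N) ^ (-1/t)`. -/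
lemma exists_le_quantizationError_of_separated {r s t : ℝ} (hr : 0 < r) (ht : 0 < t) (hs0 : 0 < s)
    (hs1 : s < 1) {n : ℕ} {G : Finset ℕ} (hG : G ⊆ values n)
    (hsep : ∀ a ∈ G, ∀ b ∈ G, a < b → a + 4 ≤ b) (hw : ∀ a ∈ G, s ≤ weight p r n a)
    (hcard : (s⁻¹) ^ t ≤ G.card) :
    ∃ c : ℝ, 0 < c ∧ ∀ᶠ N : ℕ in atTop, ENNReal.ofReal (c * (N : ℝ) ^ (1 - 1 / t)) ≤
      quantizationError (selfSimilarMeasure p) r N := by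
  refine ⟨3 ^ r * s / 2 ^ (1 / t), by positivity, ?_⟩
  filter_upwards [eventually_ge_atTop 1] with N hN
  have hN0 : (0 : ℝ) < N := by exact_mod_cast hN
  have hG1 : 1 < G.card := by
    have : (1 : ℝ) < G.card :=
      (Real.one_lt_rpow ((one_lt_inv₀ hs0).2 hs1) ht).trans_le hcard
    exact_mod_cast this
  have hex : ∃ m, 2 * N ≤ G.card ^ m := ⟨2 * N, (Nat.lt_pow_self hG1).le⟩
  obtain ⟨k, hk⟩ : ∃ k, Nat.find hex = k + 1 := by
    refine Nat.exists_eq_succ_of_ne_zero fun h0 => ?_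
    have := (Nat.find_eq_zero hex).1 h0
    rw [pow_zero] at this
    omega
  have hge : 2 * N ≤ G.card ^ (k + 1) := hk ▸ Nat.find_spec hex
  have hlt : G.card ^ k < 2 * N := not_le.1 (Nat.find_min hex (by omega))
  obtain ⟨H, -, hHsep, hHw, hHcard⟩ :=
    exists_separated_pow hp hs0.le hG hsep hw (weight_zero hs r) (k + 1)
  rw [← hHcard] at hge
  have hsk : ((2 * N : ℝ) ^ (1 / t))⁻¹ ≤ s ^ k := by
    have h1 : ((s ^ k)⁻¹) ^ t ≤ 2 * N := by
      calc ((s ^ k)⁻¹) ^ t = ((s⁻¹) ^ t) ^ k := by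
            rw [← inv_pow, ← Real.rpow_natCast_mul (by positivity),
              ← Real.rpow_mul_natCast (by positivity), mul_comm]
        _ ≤ (G.card : ℝ) ^ k := pow_le_pow_left₀ (by positivity) hcard k
        _ ≤ 2 * N := by exact_mod_cast hlt.le
    have h2 := Real.rpow_le_rpow (by positivity) h1 (one_div_nonneg.2 ht.le)
    rw [← Real.rpow_mul (by positivity), mul_one_div_cancel ht.ne', Real.rpow_one] at h2
    rw [inv_le_comm₀ (by positivity) (by positivity)]
    exact h2
  refine (ENNReal.ofReal_le_ofReal ?_).trans (le_quantizationError_of_separated hp hs hr.le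
    hHsep (n := n * (k + 1)) (c := s ^ (k + 1) * (3 ^ (n * (k + 1))) ^ r) (fun a ha => ?_) hge)
  · rw [Real.div_rpow (by norm_num) (by positivity)]
    have h3 := (three_pow_rpow_pos (n * (k + 1)) r).ne'
    calc 3 ^ r * s / 2 ^ (1 / t) * (N : ℝ) ^ (1 - 1 / t)
        = N * (3 ^ r * s * ((2 * N : ℝ) ^ (1 / t))⁻¹) := by
          rw [Real.rpow_sub hN0, Real.rpow_one, Real.mul_rpow (by norm_num) hN0.le]
          field_simp
      _ ≤ N * (3 ^ r * s * s ^ k) := by gcongr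
      _ = _ := by
          rw [pow_succ]
          field_simp
  · have := hHw a ha
    rwa [weight, le_div_iff₀ (three_pow_rpow_pos _ r)] at this

-- Pigeonhole on the residues modulo 4.
omit hp hs in
lemma exists_separated_subset (A : Finset ℕ) :
    ∃ G ⊆ A, (∀ a ∈ G, ∀ b ∈ G, a < b → a + 4 ≤ b) ∧ (A.card : ℝ) ≤ 4 * G.card := by
  obtain ⟨i, -, hi⟩ := Finset.exists_le_card_fiber_of_nsmul_le_card_of_maps_to
    (s := A) (t := Finset.range 4) (f := fun a => a % 4) (b := (A.card : ℝ) / 4)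
    (fun a _ => Finset.mem_range.2 (Nat.mod_lt _ (by norm_num))) (by simp)
    (by simp; linarith)
  refine ⟨_, Finset.filter_subset _ _, fun a ha b hb hab => ?_, by linarith⟩
  have ha' := (Finset.mem_filter.1 ha).2
  have hb' := (Finset.mem_filter.1 hb).2
  omega

/-- If the partition sums at the exponent `t'` are unbounded, then some level has, for some `s`,
many separated cells of weight at least `s`. -/
lemma exists_separated_of_unbounded {r t t' : ℝ} (hr : 0 ≤ r) (ht : 0 < t) (htt : t < t')
    (hunb : ∀ K, ∃ n, K < ∑ a ∈ values n, weight p r n a ^ t') :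
    ∃ s, 0 < s ∧ s < 1 ∧ ∃ n, ∃ G ⊆ values n, (∀ a ∈ G, ∀ b ∈ G, a < b → a + 4 ≤ b) ∧
      (∀ a ∈ G, s ≤ weight p r n a) ∧ (s⁻¹) ^ t ≤ G.card := by
  classical
  by_contra hcon
  -- Without such a family, separation costs only a factor 4, so the number of cells of weight at
  -- least `s` is `O(s ^ (-t))` uniformly in the level.
  have hcount : ∀ s, 0 < s → s < 1 → ∀ n,
      (((values n).filter fun a => s ≤ weight p r n a).card : ℝ) ≤ 4 * (s⁻¹) ^ t := by
    intro s hs0 hs1 n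
    obtain ⟨G, hG, hsep, hcard⟩ := exists_separated_subset
      ((values n).filter fun a => s ≤ weight p r n a)
    refine hcard.trans (mul_le_mul_of_nonneg_left (not_lt.1 fun h => hcon ?_) (by norm_num))
    exact ⟨s, hs0, hs1, n, G, hG.trans (Finset.filter_subset _ _), hsep,
      fun a ha => (Finset.mem_filter.1 (hG ha)).2, h.le⟩
  set q := Real.exp (t - t') with hq
  have hq1 : q < 1 := Real.exp_lt_one_iff.2 (by linarith)
  obtain ⟨n, hn⟩ := hunb (4 * Real.exp t * ∑' k : ℕ, q ^ k)
  refine absurd hn (not_lt.2 ?_)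
  -- Cells are grouped by `e^{-(k+1)} ≤ weight ≤ e^{-k}`. Group `k` has at most `4 e^{t(k+1)}`
  -- cells, each contributing at most `e^{-t'k}`: a geometric series of ratio `e^{t-t'}`, bounded
  -- independently of `n`.
  set f : ℕ → ℕ := fun a => ⌊-Real.log (weight p r n a)⌋₊ with hf
  rw [← Finset.sum_fiberwise_of_maps_to (t := (values n).image f)
    fun a ha => Finset.mem_image_of_mem f ha]
  calc _ ≤ ∑ k ∈ (values n).image f, 4 * Real.exp t * q ^ k := by
        refine Finset.sum_le_sum fun k _ => ?_
        have hk : ∀ a ∈ (values n).filter fun a => f a = k,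
            weight p r n a ≤ Real.exp (-k) ∧ Real.exp (-(k + 1)) ≤ weight p r n a := by
          intro a ha
          obtain ⟨hav, rfl⟩ := Finset.mem_filter.1 ha
          have hw := weight_pos hp r hav
          have hl : 0 ≤ -Real.log (weight p r n a) :=
            neg_nonneg.2 (Real.log_nonpos hw.le (weight_le_one hp hs hr n a))
          have h1 := Nat.floor_le hl
          have h2 := (Nat.lt_floor_add_one (-Real.log (weight p r n a))).le
          rw [← Real.log_le_iff_le_exp hw, ← Real.le_log_iff_exp_le hw]
          constructor <;> linarith
        have hcard : (((values n).filter fun a => f a = k).card : ℝ) ≤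
            4 * ((Real.exp (-(k + 1)))⁻¹) ^ t := by
          refine le_trans ?_ (hcount _ (Real.exp_pos _) (Real.exp_lt_one_iff.2 (by
            have : (0 : ℝ) ≤ k := k.cast_nonneg
            linarith)) n)
          refine Nat.cast_le.2 (Finset.card_le_card fun a ha => ?_)
          exact Finset.mem_filter.2 ⟨(Finset.mem_filter.1 ha).1, (hk a ha).2⟩
        calc _ ≤ ∑ a ∈ (values n).filter (fun a => f a = k), Real.exp (-k) ^ t' :=
              Finset.sum_le_sum fun a ha => Real.rpow_le_rpow (weight_nonneg hp _ _ _)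
                (hk a ha).1 (by linarith)
          _ = ((values n).filter fun a => f a = k).card * Real.exp (-k) ^ t' := by
              rw [Finset.sum_const, nsmul_eq_mul]
          _ ≤ 4 * ((Real.exp (-(k + 1)))⁻¹) ^ t * Real.exp (-k) ^ t' :=
              mul_le_mul_of_nonneg_right hcard (by positivity)
          _ = 4 * Real.exp t * q ^ k := by
              rw [hq, ← Real.exp_neg, ← Real.exp_mul, ← Real.exp_mul, ← Real.exp_nat_mul,
                mul_assoc, mul_assoc, ← Real.exp_add, ← Real.exp_add]
              congr 2
              ring
    _ ≤ ∑' k : ℕ, 4 * Real.exp t * q ^ k := by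
        refine Summable.sum_le_tsum _ (fun k _ => by positivity) ?_
        exact (summable_geometric_of_lt_one (Real.exp_pos _).le hq1).mul_left _
    _ = _ := tsum_mul_left

end

/-! ### The quantization dimension -/

section

variable {p : Fin 3 → ℝ} (hp : ∀ i, 0 < p i) (hs : ∑ i, p i = 1)
  {a b : Fin 3} (hab : (a = 0 ∧ b = 2) ∨ (a = 1 ∧ b = 0))

include hp hs hab

lemma tendsto_log_sum_weight_div (r : ℝ) {t : ℝ} (ht : 0 ≤ t) :
    Tendsto (fun n : ℕ => Real.log (∑ a ∈ values n, weight p r n a ^ t) / n) atTop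
      (𝓝 (pressure p a b t - r * t * Real.log 3)) := by
  refine ((tendsto_log_partition_div hp hs hab ht).sub_const _).congr' ?_
  filter_upwards [eventually_gt_atTop 0] with n hn
  have hn' : (n : ℝ) ≠ 0 := by exact_mod_cast hn.ne'
  rw [sum_weight_rpow hp, Real.log_div (partition_pos hp n t).ne' (three_pow_rpow_pos n _).ne',
    Real.log_rpow (by positivity), Real.log_pow]
  field_simp

omit hs hab in
lemma sum_weight_pos (r t : ℝ) (n : ℕ) : 0 < ∑ a ∈ values n, weight p r n a ^ t := by
  rw [sum_weight_rpow hp]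
  exact div_pos (partition_pos hp n t) (three_pow_rpow_pos n _)

lemma summable_sum_weight {r t : ℝ} (ht : 0 ≤ t)
    (h : pressure p a b t < r * t * Real.log 3) :
    Summable fun n => ∑ a ∈ values n, weight p r n a ^ t := by
  obtain ⟨c, hc, hc0⟩ := exists_between (sub_neg.2 h)
  refine Summable.of_norm_bounded_eventually_nat (g := fun n => Real.exp c ^ n)
    (summable_geometric_of_lt_one (Real.exp_pos c).le (Real.exp_lt_one_iff.2 hc0)) ?_
  filter_upwards [(tendsto_log_sum_weight_div hp hs hab r ht).eventually_lt_const hc,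
    eventually_gt_atTop 0] with n hn hn0
  have hn' : (0 : ℝ) < n := by exact_mod_cast hn0
  have hpos := sum_weight_pos hp r t n
  rw [Real.norm_of_nonneg hpos.le, ← Real.exp_nat_mul, ← Real.log_le_iff_le_exp hpos]
  rw [div_lt_iff₀ hn'] at hn
  linarith

lemma sum_weight_unbounded {r t : ℝ} (ht : 0 ≤ t)
    (h : r * t * Real.log 3 < pressure p a b t) (K : ℝ) :
    ∃ n, K < ∑ a ∈ values n, weight p r n a ^ t := by
  obtain ⟨c, hc0, hc⟩ := exists_between (sub_pos.2 h)
  have hgeo := tendsto_pow_atTop_atTop_of_one_lt (Real.one_lt_exp_iff.2 hc0)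
  obtain ⟨n, hn, hn0, hK⟩ :=
    (((tendsto_log_sum_weight_div hp hs hab r ht).eventually_const_lt hc).and
      ((eventually_gt_atTop 0).and (hgeo.eventually_gt_atTop K))).exists
  have hn' : (0 : ℝ) < n := by exact_mod_cast hn0
  refine ⟨n, hK.trans_le ?_⟩
  rw [← Real.exp_nat_mul, ← Real.le_log_iff_exp_le (sum_weight_pos hp r t n)]
  rw [lt_div_iff₀ hn'] at hn
  linarith

lemma exists_quantizationError_le_of_pressure_lt {r t : ℝ} (hr : 0 < r) (ht : 0 < t)
    (h : pressure p a b t < r * t * Real.log 3) :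
    ∃ C : ℝ, 0 < C ∧ ∀ᶠ N : ℕ in atTop, quantizationError (selfSimilarMeasure p) r N ≤
      ENNReal.ofReal (C * (N : ℝ) ^ (1 - 1 / t)) :=
  exists_quantizationError_le hp hs hr ht (summable_sum_weight hp hs hab ht.le h)

lemma exists_le_quantizationError_of_lt_pressure {r t t' : ℝ} (hr : 0 < r) (ht : 0 < t)
    (htt : t < t') (h : r * t' * Real.log 3 < pressure p a b t') :
    ∃ c : ℝ, 0 < c ∧ ∀ᶠ N : ℕ in atTop, ENNReal.ofReal (c * (N : ℝ) ^ (1 - 1 / t)) ≤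
      quantizationError (selfSimilarMeasure p) r N := by
  obtain ⟨s, hs0, hs1, n, G, hG, hsep, hw, hcard⟩ := exists_separated_of_unbounded hp hs hr.le ht
    htt (sum_weight_unbounded hp hs hab (ht.trans htt).le h)
  exact exists_le_quantizationError_of_separated hp hs hr ht hs0 hs1 hG hsep hw hcard

end

lemma tendsto_log_natCast : Tendsto (fun N : ℕ => Real.log N) atTop atTop :=
  Real.tendsto_log_atTop.comp tendsto_natCast_atTop_atTop

lemma tendsto_log_toReal_div_log {v : ℕ → ℝ≥0∞} {t₀ : ℝ} (h0 : 0 < t₀) (h1 : t₀ < 1)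
    (hupper : ∀ t, t₀ < t → ∃ C : ℝ, 0 < C ∧ ∀ᶠ N : ℕ in atTop,
      v N ≤ ENNReal.ofReal (C * (N : ℝ) ^ (1 - 1 / t)))
    (hlower : ∀ t, 0 < t → t < t₀ → ∃ c : ℝ, 0 < c ∧ ∀ᶠ N : ℕ in atTop,
      ENNReal.ofReal (c * (N : ℝ) ^ (1 - 1 / t)) ≤ v N) :
    Tendsto (fun N : ℕ => Real.log (v N).toReal / Real.log N) atTop (𝓝 (1 - 1 / t₀)) := by
  have hinv : 1 < 1 / t₀ := (one_lt_div h0).2 h1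
  have hsmall : ∀ c y : ℝ, Tendsto (fun N : ℕ => Real.log c / Real.log N + y) atTop (𝓝 y) :=
    fun c y => by simpa using (tendsto_log_natCast.const_div_atTop (Real.log c)).add_const y
  have hlog : ∀ {c y : ℝ}, 0 < c → ∀ {N : ℕ}, 1 < N →
      Real.log (c * (N : ℝ) ^ y) / Real.log N = Real.log c / Real.log N + y := by
    intro c y hc N hN
    have hN1 : (1 : ℝ) < N := by exact_mod_cast hN
    have hN0 : (0 : ℝ) < N := by linarith
    rw [Real.log_mul hc.ne' (Real.rpow_pos_of_pos hN0 y).ne', Real.log_rpow hN0]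
    have := (Real.log_pos hN1).ne'
    field_simp
  -- One exponent on each side makes `v N` eventually finite and positive, so that `toReal` and
  -- `log` take no default value.
  obtain ⟨C, hC, hfin⟩ := hupper 1 h1
  obtain ⟨c, hc, hpos⟩ := hlower (t₀ / 2) (by linarith) (by linarith)
  have hvpos : ∀ᶠ N : ℕ in atTop, 0 < (v N).toReal := by
    filter_upwards [hfin, hpos, eventually_gt_atTop 0] with N hN hN' hN0
    have hN0' : (0 : ℝ) < N := by exact_mod_cast hN0
    refine ENNReal.toReal_pos (ne_of_gt ?_) (hN.trans_lt ENNReal.ofReal_lt_top).ne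
    exact (ENNReal.ofReal_pos.2 (by positivity)).trans_le hN'
  rw [tendsto_order]
  constructor
  · intro x hx
    obtain ⟨y, hxy, hy⟩ := exists_between hx
    have hy1 : 0 < 1 - y := by linarith
    -- The choice `t = 1 / (1 - y)` turns the exponent `1 - 1 / t` into `y`.
    obtain ⟨c, hc, h⟩ := hlower (1 / (1 - y)) (by positivity)
      ((one_div_lt hy1 h0).2 (by linarith))
    rw [one_div_one_div, sub_sub_cancel] at h
    filter_upwards [h, hfin, eventually_gt_atTop 1, (hsmall c y).eventually_const_lt hxy]
      with N hN hN' hN1 hlt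
    have hN1' : (1 : ℝ) < N := by exact_mod_cast hN1
    have hN0' : (0 : ℝ) < N := by linarith
    rw [← hlog hc hN1] at hlt
    refine hlt.trans_le (div_le_div_of_nonneg_right
      (Real.log_le_log (by positivity) ?_) (Real.log_pos hN1').le)
    exact (ENNReal.ofReal_le_iff_le_toReal (hN'.trans_lt ENNReal.ofReal_lt_top).ne).1 hN
  · intro x hx
    -- Keeping `y` negative makes `1 - y` positive, so that `1 / (1 - y)` is an admissible exponent.
    obtain ⟨y, hy, hyx⟩ := exists_between (lt_min hx (show 1 - 1 / t₀ < 0 by linarith))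
    rw [lt_min_iff] at hyx
    have hy1 : 0 < 1 - y := by linarith
    obtain ⟨c, hc, h⟩ := hupper (1 / (1 - y)) ((lt_one_div h0 hy1).2 (by linarith))
    rw [one_div_one_div, sub_sub_cancel] at h
    filter_upwards [h, hvpos, eventually_gt_atTop 1, (hsmall c y).eventually_lt_const hyx.1]
      with N hN hv hN1 hlt
    have hN1' : (1 : ℝ) < N := by exact_mod_cast hN1
    have hN0' : (0 : ℝ) < N := by linarith
    rw [← hlog hc hN1] at hlt
    refine lt_of_le_of_lt (div_le_div_of_nonneg_right (Real.log_le_log hv ?_)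
      (Real.log_pos hN1').le) hlt
    exact ENNReal.toReal_le_of_le_ofReal (by positivity) hN

/-- As `log e = (log V) / r`, the quotient defining the dimension is `-r` times the inverse of `log
V / log N`. -/
lemma hasQuantizationDim_of_tendsto {X : Type*} [PseudoMetricSpace X] [MeasurableSpace X]
    {μ : Measure X} {r t₀ : ℝ} (hr : 0 < r) (h0 : 0 < t₀) (h1 : t₀ < 1)
    (h : Tendsto (fun N : ℕ => Real.log (quantizationError μ r N).toReal / Real.log N) atTop
      (𝓝 (1 - 1 / t₀))) : HasQuantizationDim μ r (t₀ * r / (1 - t₀)) := by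
  have hinv : 1 < 1 / t₀ := (one_lt_div h0).2 h1
  have hlim : Tendsto (fun N : ℕ => Real.log N / -Real.log (normalizedError μ r N)) atTop
      (𝓝 (t₀ * r / (1 - t₀))) := by
    have h2 := (h.inv₀ (by linarith)).const_mul (-r)
    have hval : -r * (1 - 1 / t₀)⁻¹ = t₀ * r / (1 - t₀) := by
      have h3 : 1 - t₀ ≠ 0 := by linarith
      have h4 : 1 - 1 / t₀ = -(1 - t₀) / t₀ := by field_simp; ring
      rw [h4, inv_div]
      field_simp
    rw [hval] at h2
    refine h2.congr' ?_
    -- A strictly negative quotient rules out `V = 0` and `log V = 0`, including the default values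
    -- of `toReal` and `log`.
    filter_upwards [h.eventually_lt_const (show 1 - 1 / t₀ < 0 by linarith)] with N hN
    have hv : 0 < (quantizationError μ r N).toReal := by
      refine lt_of_le_of_ne ENNReal.toReal_nonneg fun h0 => ?_
      rw [← h0] at hN
      simp at hN
    rw [normalizedError, Real.log_rpow hv, inv_div]
    have hl : Real.log (quantizationError μ r N).toReal ≠ 0 := fun h0 => by
      rw [h0] at hN
      simp at hN
    field_simp
  have hE := (continuous_coe_real_ereal.tendsto _).comp hlim
  exact ⟨hE.liminf_eq, hE.limsup_eq⟩

end Overlap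

end

theorem theorem3p1 :
    Overlap.WeakSeparation Overlap.S ∧ ¬ Overlap.OpenSetCondition Overlap.S ∧
    ∀ (p : Fin 3 → ℝ), (∀ i, 0 < p i) → ∑ i, p i = 1 →
    ∀ (a b : Fin 3),
      -- forbid the pair (0,3) if p₃ ≤ p₁, and the pair (1,0) if p₁ ≤ p₃
      (p 2 ≤ p 1 ∧ a = 0 ∧ b = 2) ∨ (p 1 ≤ p 2 ∧ a = 1 ∧ b = 0) →
      -- the limit that defines the pressure exists
      (∀ t : ℝ, 0 ≤ t →
        Tendsto (Overlap.pressureSeq p a b t) atTop (𝓝 (Overlap.pressure p a b t))) ∧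
      ∀ r : ℝ, 0 < r →
        ∃ t₀ : ℝ, (0 < t₀ ∧ t₀ < 1) ∧
          Overlap.pressure p a b t₀ = r * t₀ * Real.log 3 ∧
          (∀ t : ℝ, 0 < t → t < 1 → Overlap.pressure p a b t = r * t * Real.log 3 → t = t₀) ∧
          Overlap.HasQuantizationDim (Overlap.selfSimilarMeasure p) r (t₀ * r / (1 - t₀)) := by
  refine ⟨Overlap.weakSeparation_S, Overlap.not_openSetCondition_S, fun p hp hs a b h => ?_⟩
  have hab : (a = 0 ∧ b = 2) ∨ (a = 1 ∧ b = 0) := h.imp And.right And.right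
  refine ⟨fun t ht => Overlap.tendsto_pressureSeq hp hs hab ht, fun r hr => ?_⟩
  obtain ⟨t₀, ⟨h0, h1⟩, ht₀⟩ := Overlap.exists_pressure_eq hp hs hab hr
  refine ⟨t₀, ⟨h0, h1⟩, ht₀, fun t ht _ heq => ?_, ?_⟩
  · rcases lt_trichotomy t t₀ with hlt | rfl | hlt
    · exact absurd heq (Overlap.lt_pressure_of_lt hp hs hab hr ht.le hlt ht₀).ne'
    · rfl
    · exact absurd heq (Overlap.pressure_lt_of_lt hp hs hab hr h0.le hlt ht₀).ne
  · refine Overlap.hasQuantizationDim_of_tendsto hr h0 h1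
      (Overlap.tendsto_log_toReal_div_log h0 h1 (fun t ht => ?_) fun t ht htt => ?_)
    · exact Overlap.exists_quantizationError_le_of_pressure_lt hp hs hab hr (h0.trans ht)
        (Overlap.pressure_lt_of_lt hp hs hab hr h0.le ht ht₀)
    · obtain ⟨t', htt', ht'⟩ := exists_between htt
      exact Overlap.exists_le_quantizationError_of_lt_pressure hp hs hab hr ht htt'
        (Overlap.lt_pressure_of_lt hp hs hab hr (ht.trans htt').le ht' ht₀)
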